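/- Let $\mathcal H$ be a separable complex Hilbert space, $A_0$ a self-adjoint operator in $\mathcal H$ with $0\in\rho(A_0)$, $\mathcal E$ a complex Hilbert space, $\Pi:\mathcal E\to\mathcal H$ a bounded operator with $\operatorname{dom}(A_0)\cap\operatorname{ran}(\Pi)=\{0\}$ and $\ker\Pi=\{0\}$, and $\Lambda$ a self-adjoint operator in $\mathcal E$. For $f\in\mathcal H$ define $$A:A_0^{-1}f+\Pi\phi\mapsto f,\qquad \Gamma_0:A_0^{-1}f+\Pi\phi\mapsto\phi\qquad(\phi\in\mathcal E),\qquad \Gamma_1:A_0^{-1}f+\Pi\phi\mapsto\Pi^*f+\Lambda\phi\qquad(\phi\in\operatorname{dom}\Lambda),$$ so that $\operatorname{dom}A=\operatorname{dom}\Gamma_0=\operatorname{dom}A_0\dotplus\operatorname{ran}\Pi$ and $\operatorname{dom}\Gamma_1=\operatorname{dom}A_0\dotplus\Pi\operatorname{dom}\Lambda$. For $z\in\rho(A_0)$ let $\gamma(z)=(I+z(A_0-zI)^{-1})\Pi$, and let $M(z)=\Gamma_1\gamma(z)$ with $\operatorname{dom}M(z)=\operatorname{dom}\Lambda$. For $z\in\mathbb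 C_+$ let $S(z)=(M(z)-iI)(M(z)+iI)^{-1}=I-2i(M(z)+iI)^{-1}$, and for $z\in\mathbb C_-$ let $S^*(\bar z)=[S(\bar z)]^*$. Let $L=A_{-iI,I}$ be the restriction of $A$ to $\ker(\Gamma_1-i\Gamma_0)$. Let $\partial_\pm$ be the operator $y\mapsto iy'$ in $L^2(\mathbb R_\pm,\mathcal E)$ with domain the Sobolev space $W^1_2(\mathbb R_\pm,\mathcal E)$, and let $\partial^0_\pm$ be its restriction to the closure in $W^1_2(\mathbb R_\pm,\mathcal E)$ of the smooth functions with compact support in the open half-line $\mathbb R_\pm$. In $\mathscr H=L^2(\mathbb R_-,\mathcal E)\oplus\mathcal H\oplus L^2(\mathbb R_+,\mathcal E)$ let $\mathscr A(v_-,u,v_+)=(iv_-',Au,iv_+')$ on the domain of all $(v_-,u,v_+)\in\mathscr H$ such that $v_\pm\in W^1_2(\mathbb R_\pm,\mathcal E)$, $u\in\operatorname{dom}\Gamma_1$ and $\Gamma_1u\pm i\Gamma_0u=\sqrt2\,v_\pm(0)$ (both signs). Then: 1. $L$ is a maximal dissipative operator: it is densely defined, $\operatorname{Im}\langle Lu,u\rangle\ge0$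 for $u\in\operatorname{dom}L$, and $\mathbb C_-\subset\rho(L)$. Whenever $z\in\rho(A_0)$ and $M(z)-iI$ is boundedly invertible, $z\in\rho(L)$ and $(L-zI)^{-1}=(A_0-zI)^{-1}-\gamma(z)(M(z)-iI)^{-1}\Pi^*(I+z(A_0-zI)^{-1})$. 2. $\mathscr A$ is self-adjoint. 3. $\mathscr A$ is an extension of $L$ in the sense of dilation theory: $u\in\operatorname{dom}L$ if and only if $(0,u,v_+)\in\operatorname{dom}\mathscr A$ for some $v_+$; for all such $u,v_+$ the first component of $\mathscr A(0,u,v_+)$ is $0$ and its middle component is $Lu$; and $P_{\mathcal H}(\mathscr A-zI)^{-1}|_{\mathcal H}=(L-zI)^{-1}$ for all $z\in\mathbb C_-$. 4. For $z\in\mathbb C_-$ one has $z\in\rho(A_0)\cap\rho(L)\cap\rho(\partial_-)\cap\rho(\partial^0_+)\cap\rho(\mathscr A)$, the operators $M(z)-iI$ and $M(\bar z)+iI$ are boundedly invertible, the range of $(L-zI)^{-1}$ lies in $\operatorname{dom}\Gamma_0$, and $(\mathscr A-zI)^{-1}(h_-,h,h_+)=(f_-,f,f_+)$ for all $(h_-,h,h_+)\in\mathscr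 H$, where $$f_-=(\partial_--zI)^{-1}h_-,\qquad f=(L-zI)^{-1}h+\sqrt2\,\gamma(z)(M(z)-iI)^{-1}f_-(0),$$ $$f_+=(\partial^0_+-zI)^{-1}h_++e^{-iz\,\cdot}\bigl[i\sqrt2\,\Gamma_0(L-zI)^{-1}h+S^*(\bar z)f_-(0)\bigr].$$ 5. For $z\in\mathbb C_+$ one has $z\in\rho(A_0)\cap\rho(L^*)\cap\rho(\partial_+)\cap\rho(\partial^0_-)\cap\rho(\mathscr A)$, the operator $M(z)+iI$ is boundedly invertible, the range of $(L^*-zI)^{-1}$ lies in $\operatorname{dom}\Gamma_0$, and $(\mathscr A-zI)^{-1}(h_-,h,h_+)=(f_-,f,f_+)$ for all $(h_-,h,h_+)\in\mathscr H$, where $$f_+=(\partial_+-zI)^{-1}h_+,\qquad f=(L^*-zI)^{-1}h+\sqrt2\,\gamma(z)(M(z)+iI)^{-1}f_+(0),$$ $$f_-=(\partial^0_--zI)^{-1}h_-+e^{-iz\,\cdot}\bigl[-i\sqrt2\,\Gamma_0(L^*-zI)^{-1}h+S(z)f_+(0)\bigr].$$ -/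

import Mathlib

open MeasureTheory Set
open scoped InnerProductSpace ContDiff ComplexConjugate

noncomputable section

/-! ## Resolvents of unbounded operators -/

namespace UnboundedOp

variable {V W : Type*} [NormedAddCommGroup V] [NormedSpace ℂ V]
  [NormedAddCommGroup W] [NormedSpace ℂ W]

/-- The operator `T - z I`, on the domain of `T`. -/
def subScalar (T : V →ₗ.[ℂ] V) (z : ℂ) : V →ₗ.[ℂ] V where
  domain := T.domain
  toFun := T.toFun - z • T.domain.subtype

/-- The bounded operator `R`, defined everywhere on `W`, is the inverse of the operator `T`. -/
def IsBoundedInverse (T : V →ₗ.[ℂ] W) (R : W →L[ℂ] V) : Prop :=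
  (∀ x : T.domain, R (T x) = x) ∧ ∀ y : W, ∃ h : R y ∈ T.domain, T ⟨R y, h⟩ = y

/-- `T` is boundedly invertible. -/
def HasBoundedInverse (T : V →ₗ.[ℂ] W) : Prop :=
  ∃ R : W →L[ℂ] V, IsBoundedInverse T R

theorem IsBoundedInverse.unique {T : V →ₗ.[ℂ] W} {R R' : W →L[ℂ] V}
    (h : IsBoundedInverse T R) (h' : IsBoundedInverse T R') : R = R' := by
  ext y
  obtain ⟨hy, hTy⟩ := h'.2 y
  have := h.1 ⟨R' y, hy⟩
  rwa [hTy] at this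

open Classical in
/-- The bounded inverse of `T` (`0` if `T` is not boundedly invertible). -/
def boundedInverse (T : V →ₗ.[ℂ] W) : W →L[ℂ] V :=
  if h : HasBoundedInverse T then h.choose else 0

theorem boundedInverse_spec {T : V →ₗ.[ℂ] W} (h : HasBoundedInverse T) :
    IsBoundedInverse T (boundedInverse T) := by
  rw [boundedInverse, dif_pos h]
  exact h.choose_spec

theorem boundedInverse_of_not {T : V →ₗ.[ℂ] W} (h : ¬ HasBoundedInverse T) :
    boundedInverse T = 0 := by
  rw [boundedInverse, dif_neg h]

/-- The resolvent set `ρ(T)` of an unbounded operator. -/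
def resolventSetOp (T : V →ₗ.[ℂ] V) : Set ℂ :=
  {z | HasBoundedInverse (subScalar T z)}

/-- The resolvent `(T - z I)⁻¹` (`0` if `z` is not in the resolvent set). -/
def resolventOp (T : V →ₗ.[ℂ] V) (z : ℂ) : V →L[ℂ] V :=
  boundedInverse (subScalar T z)

end UnboundedOp

open UnboundedOp

/-- A maximal dissipative operator: densely defined, with `Im ⟨L u, u⟩ ≥ 0` on its domain (for an
inner product that is linear in its first argument; `inner ℂ` is linear in the second), and with
the open lower half-plane contained in its resolvent set. -/
def IsMaximalDissipative {V : Type*} [NormedAddCommGroup V] [InnerProductSpace ℂ V]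
    (L : V →ₗ.[ℂ] V) : Prop :=
  Dense (L.domain : Set V) ∧ (∀ u : L.domain, 0 ≤ (inner ℂ (u : V) (L u)).im) ∧
    ∀ z : ℂ, z.im < 0 → z ∈ resolventSetOp L

/-! ## Vector-valued Sobolev spaces on an open subset of the line -/

namespace HalfLine

variable {E : Type*} [NormedAddCommGroup E] [InnerProductSpace ℂ E]

variable (E) in
/-- The space `L²(s, E)` of square-integrable functions on a subset `s` of the line. -/
abbrev L2 (s : Set ℝ) : Type _ := Lp E 2 (volume.restrict s)

/-- `w` is the weak (distributional) derivative of `v` on `s`. -/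
def IsWeakDeriv {s : Set ℝ} (v w : L2 E s) : Prop :=
  ∀ η : ℝ → ℝ, ContDiff ℝ ∞ η → HasCompactSupport η → tsupport η ⊆ s →
    ∫ x in s, deriv η x • v x = - ∫ x in s, η x • w x

theorem integrable_smul_L2 {s : Set ℝ} (v : L2 E s) {η : ℝ → ℝ} (hη : Continuous η)
    (hc : HasCompactSupport η) : Integrable (fun x => η x • v x) (volume.restrict s) := by
  have h1 : MemLp η 2 (volume.restrict s) := hη.memLp_of_hasCompactSupport hc
  have h2 : MemLp (η • (v : ℝ → E)) 1 (volume.restrict s) := (Lp.memLp v).smul h1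
  exact memLp_one_iff_integrable.1 h2

/-- The set of pairs `(v, w)` in `L²(s, E)` such that `w` is the weak derivative of `v`. -/
def weakDerivGraph (s : Set ℝ) : Submodule ℂ (L2 E s × L2 E s) where
  carrier := {p | IsWeakDeriv p.1 p.2}
  zero_mem' := by
    intro η h1 h2 h3
    have h : ((0 : L2 E s) : ℝ → E) =ᵐ[volume.restrict s] 0 := Lp.coeFn_zero _ _ _
    have e1 : ∫ x in s, deriv η x • (0 : L2 E s) x = 0 :=
      integral_eq_zero_of_ae (h.mono fun x hx => by
        beta_reduce
        rw [hx, Pi.zero_apply, smul_zero])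
    have e2 : ∫ x in s, η x • (0 : L2 E s) x = 0 :=
      integral_eq_zero_of_ae (h.mono fun x hx => by
        beta_reduce
        rw [hx, Pi.zero_apply, smul_zero])
    simp only [Prod.fst_zero, Prod.snd_zero]
    rw [e1, e2, neg_zero]
  add_mem' := by
    rintro ⟨v, w⟩ ⟨v', w'⟩ hp hq η h1 h2 h3
    have hd : Continuous (deriv η) := h1.continuous_deriv (by simp)
    have key : ∀ (a b : L2 E s) (ζ : ℝ → ℝ), Continuous ζ → HasCompactSupport ζ →
        ∫ x in s, ζ x • (a + b) x = (∫ x in s, ζ x • a x) + ∫ x in s, ζ x • b x := by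
      intro a b ζ hζ hc
      rw [← integral_add (integrable_smul_L2 a hζ hc) (integrable_smul_L2 b hζ hc)]
      refine integral_congr_ae ((Lp.coeFn_add a b).mono fun x hx => ?_)
      change ζ x • (a + b) x = ζ x • a x + ζ x • b x
      rw [hx, Pi.add_apply, smul_add]
    have hp' := hp η h1 h2 h3
    have hq' := hq η h1 h2 h3
    simp only [Prod.fst_add, Prod.snd_add] at hp' hq' ⊢
    rw [key _ _ _ hd h2.deriv, key _ _ _ h1.continuous h2, hp', hq', neg_add]
  smul_mem' := by
    rintro c ⟨v, w⟩ hp η h1 h2 h3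
    have key : ∀ (a : L2 E s) (ζ : ℝ → ℝ),
        ∫ x in s, ζ x • (c • a) x = c • ∫ x in s, ζ x • a x := by
      intro a ζ
      rw [← integral_smul]
      refine integral_congr_ae ((Lp.coeFn_smul c a).mono fun x hx => ?_)
      change ζ x • (c • a) x = c • ζ x • a x
      rw [hx, Pi.smul_apply, smul_comm]
    have hp' := hp η h1 h2 h3
    simp only [Prod.smul_fst, Prod.smul_snd] at hp' ⊢
    rw [key, key, hp', smul_neg]

/-- Weak derivatives on open sets are unique. -/
theorem weakDerivGraph_unique [CompleteSpace E] {s : Set ℝ} (hs : IsOpen s)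
    (p : L2 E s × L2 E s) (hp : p ∈ weakDerivGraph s) (h0 : p.1 = 0) : p.2 = 0 := by
  obtain ⟨v, w⟩ := p
  simp only at h0
  subst h0
  have hw : LocallyIntegrableOn (w : ℝ → E) s volume := by
    have : LocallyIntegrable (w : ℝ → E) (volume.restrict s) :=
      (Lp.memLp w).locallyIntegrable (by norm_num)
    exact locallyIntegrableOn_of_locallyIntegrable_restrict this
  have h0 : ∀ᵐ x ∂volume, x ∈ s → w x = 0 := by
    refine hs.ae_eq_zero_of_integral_contDiff_smul_eq_zero hw fun η h1 h2 h3 => ?_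
    have h := hp η h1 h2 h3
    have hz : ((0 : L2 E s) : ℝ → E) =ᵐ[volume.restrict s] 0 := Lp.coeFn_zero _ _ _
    have e1 : ∫ x in s, deriv η x • (0 : L2 E s) x = 0 :=
      integral_eq_zero_of_ae (hz.mono fun x hx => by
        beta_reduce
        rw [hx, Pi.zero_apply, smul_zero])
    simp only at h
    rw [e1, eq_comm, neg_eq_zero] at h
    rw [← h, eq_comm]
    refine setIntegral_eq_integral_of_forall_compl_eq_zero fun x hx => ?_
    have : η x = 0 := image_eq_zero_of_notMem_tsupport fun hx' => hx (h3 hx')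
    simp [this]
  rw [Lp.ext_iff]
  refine Filter.EventuallyEq.trans ?_ (Lp.coeFn_zero _ _ _).symm
  exact (ae_restrict_iff' hs.measurableSet).2 h0

variable (E) in
/-- The weak derivative `v ↦ v'` as an operator in `L²(s, E)`, whose domain is the Sobolev space
`W¹₂(s, E)` of all `v` in `L²(s, E)` that have a weak derivative in `L²(s, E)`. -/
def sobolevDeriv (s : Set ℝ) : L2 E s →ₗ.[ℂ] L2 E s :=
  (weakDerivGraph s).toLinearPMap

theorem sobolevDeriv_graph [CompleteSpace E] {s : Set ℝ} (hs : IsOpen s) :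
    (sobolevDeriv E s).graph = weakDerivGraph s :=
  Submodule.toLinearPMap_graph_eq _ (weakDerivGraph_unique hs)

variable (E) in
/-- The Sobolev space `W¹₂(s, E)`. -/
abbrev W12 (s : Set ℝ) : Submodule ℂ (L2 E s) := (sobolevDeriv E s).domain

theorem mem_W12_iff {s : Set ℝ} (v : L2 E s) : v ∈ W12 E s ↔ ∃ w, IsWeakDeriv v w := by
  constructor
  · rintro ⟨⟨_, w⟩, hp, rfl⟩
    exact ⟨w, hp⟩
  · rintro ⟨w, hw⟩
    exact ⟨(v, w), hw, rfl⟩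

variable (E) in
/-- The pairs `(η, η')`, for `η` a smooth function with compact support in `s`. -/
def testGraph (s : Set ℝ) : Submodule ℂ (L2 E s × L2 E s) where
  carrier := {p | ∃ η : ℝ → E, ContDiff ℝ ∞ η ∧ HasCompactSupport η ∧ tsupport η ⊆ s ∧
    p.1 =ᵐ[volume.restrict s] η ∧ p.2 =ᵐ[volume.restrict s] deriv η}
  zero_mem' := by
    refine ⟨0, contDiff_const, HasCompactSupport.zero, by simp [tsupport],
      Lp.coeFn_zero _ _ _, ?_⟩
    have : deriv (0 : ℝ → E) = 0 := by ext x; simp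
    rw [this]
    exact Lp.coeFn_zero _ _ _
  add_mem' := by
    rintro ⟨v, w⟩ ⟨v', w'⟩ ⟨η, h1, h2, h3, h4, h5⟩ ⟨η', h1', h2', h3', h4', h5'⟩
    refine ⟨η + η', h1.add h1', h2.add h2',
      (tsupport_add η η').trans (union_subset h3 h3'),
      (Lp.coeFn_add v v').trans (h4.add h4'), (Lp.coeFn_add w w').trans ?_⟩
    have : deriv (η + η') = deriv η + deriv η' := by
      ext x
      exact deriv_add (h1.differentiable (by simp) x) (h1'.differentiable (by simp) x)
    rw [this]
    exact h5.add h5'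
  smul_mem' := by
    rintro c ⟨v, w⟩ ⟨η, h1, h2, h3, h4, h5⟩
    refine ⟨c • η, h1.const_smul c, h2.smul_left (f := fun _ => c),
      (closure_mono (Function.support_const_smul_subset c η)).trans h3,
      (Lp.coeFn_smul c v).trans (h4.const_smul c), (Lp.coeFn_smul c w).trans ?_⟩
    have : deriv (c • η) = c • deriv η := by
      ext x
      exact deriv_const_smul c (h1.differentiable (by simp) x)
    rw [this]
    exact h5.const_smul c

variable (E) in
/-- The closure in `W¹₂(s, E)` of the smooth functions with compact support in `s`. -/
def W12zero (s : Set ℝ) : Submodule ℂ (L2 E s) :=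
  ((testGraph E s).topologicalClosure ⊓ (sobolevDeriv E s).graph).map
    (LinearMap.fst ℂ (L2 E s) (L2 E s))

variable (E) in
/-- The operator `y ↦ i y'` in `L²(s, E)` with domain `W¹₂(s, E)`. -/
def momentum (s : Set ℝ) : L2 E s →ₗ.[ℂ] L2 E s :=
  Complex.I • sobolevDeriv E s

variable (E) in
/-- The operator `y ↦ i y'` in `L²(s, E)` whose domain is the closure in `W¹₂(s, E)` of the smooth
functions with compact support in `s`. -/
def momentumZero (s : Set ℝ) : L2 E s →ₗ.[ℂ] L2 E s :=
  (momentum E s).domRestrict (W12zero E s)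

/-- `v(0) = e`: the function `v` has a representative that is continuous up to the boundary
of `s`, with value `e` at the point `0`. -/
def HasBoundaryValue {s : Set ℝ} (v : L2 E s) (e : E) : Prop :=
  ∃ g : ℝ → E, ContinuousOn g (closure s) ∧ v =ᵐ[volume.restrict s] g ∧ g 0 = e

open Classical in
/-- The boundary value `v(0)` (`0` if `v` has none). -/
def boundaryValue {s : Set ℝ} (v : L2 E s) : E :=
  if h : ∃ e, HasBoundaryValue v e then h.choose else 0

theorem HasBoundaryValue.zero {s : Set ℝ} : HasBoundaryValue (0 : L2 E s) 0 :=
  ⟨0, continuousOn_const, Lp.coeFn_zero _ _ _, rfl⟩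

theorem HasBoundaryValue.add {s : Set ℝ} {v v' : L2 E s} {e e' : E}
    (h : HasBoundaryValue v e) (h' : HasBoundaryValue v' e') :
    HasBoundaryValue (v + v') (e + e') := by
  obtain ⟨g, h1, h2, h3⟩ := h
  obtain ⟨g', h1', h2', h3'⟩ := h'
  exact ⟨g + g', h1.add h1', (Lp.coeFn_add v v').trans (h2.add h2'), by simp [h3, h3']⟩

theorem HasBoundaryValue.smul {s : Set ℝ} {v : L2 E s} {e : E} (c : ℂ)
    (h : HasBoundaryValue v e) : HasBoundaryValue (c • v) (c • e) := by
  obtain ⟨g, h1, h2, h3⟩ := h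
  exact ⟨c • g, h1.const_smul c, (Lp.coeFn_smul c v).trans (h2.const_smul c), by simp [h3]⟩

end HalfLine

open HalfLine

/-! ## Ryzhov triples -/

/-- A triple `(A₀, Π, Λ)`: a self-adjoint operator `A₀` in `H` with `0 ∈ ρ(A₀)`, a bounded
operator `Π : E → H` with `dom A₀ ∩ ran Π = {0}` and `ker Π = {0}`, and a self-adjoint operator
`Λ` in `E`. -/
structure RyzhovTriple (H E : Type*) [NormedAddCommGroup H] [InnerProductSpace ℂ H]
    [CompleteSpace H] [NormedAddCommGroup E] [InnerProductSpace ℂ E] [CompleteSpace E] where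
  A₀ : H →ₗ.[ℂ] H
  Pi : E →L[ℂ] H
  Lam : E →ₗ.[ℂ] E
  isSelfAdjoint_A₀ : IsSelfAdjoint A₀
  zero_mem_resolventSet : (0 : ℂ) ∈ resolventSetOp A₀
  domain_inf_range : A₀.domain ⊓ LinearMap.range Pi.toLinearMap = ⊥
  ker_Pi : LinearMap.ker Pi.toLinearMap = ⊥
  isSelfAdjoint_Lam : IsSelfAdjoint Lam

namespace RyzhovTriple

variable {H E : Type*} [NormedAddCommGroup H] [InnerProductSpace ℂ H] [CompleteSpace H]
  [NormedAddCommGroup E] [InnerProductSpace ℂ E] [CompleteSpace E] (T : RyzhovTriple H E)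

/-- The bounded operator `A₀⁻¹`. -/
def A₀inv : H →L[ℂ] H := resolventOp T.A₀ 0

theorem A₀inv_mem (f : H) : T.A₀inv f ∈ T.A₀.domain :=
  ((boundedInverse_spec T.zero_mem_resolventSet).2 f).1

theorem A₀_A₀inv (f : H) : T.A₀ ⟨T.A₀inv f, T.A₀inv_mem f⟩ = f := by
  obtain ⟨h, h'⟩ := (boundedInverse_spec T.zero_mem_resolventSet).2 f
  change (T.A₀.toFun - (0 : ℂ) • T.A₀.domain.subtype) ⟨T.A₀inv f, h⟩ = f at h'
  rw [zero_smul, sub_zero] at h'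
  exact h'

theorem A₀inv_A₀ (u : T.A₀.domain) : T.A₀inv (T.A₀ u) = u := by
  have h := (boundedInverse_spec T.zero_mem_resolventSet).1 u
  have e : (subScalar T.A₀ 0) u = T.A₀ u := by
    change (T.A₀.toFun - (0 : ℂ) • T.A₀.domain.subtype) u = T.A₀ u
    simp
  rwa [e] at h

/-- The map `(f, φ) ↦ A₀⁻¹ f + Π φ`, for `f ∈ H` and `φ ∈ D`. -/
def compose (D : Submodule ℂ E) : (H × D) →ₗ[ℂ] H :=
  T.A₀inv.toLinearMap ∘ₗ LinearMap.fst ℂ H D +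
    T.Pi.toLinearMap ∘ₗ D.subtype ∘ₗ LinearMap.snd ℂ H D

theorem compose_apply (D : Submodule ℂ E) (f : H) (φ : D) :
    T.compose D (f, φ) = T.A₀inv f + T.Pi φ := rfl

theorem compose_injective (D : Submodule ℂ E) : Function.Injective (T.compose D) := by
  rw [← LinearMap.ker_eq_bot, LinearMap.ker_eq_bot']
  rintro ⟨f, φ⟩ h
  rw [compose_apply] at h
  have h1 : T.A₀inv f = 0 := by
    have hm : T.A₀inv f ∈ T.A₀.domain ⊓ LinearMap.range T.Pi.toLinearMap := by
      refine ⟨T.A₀inv_mem f, ⟨-(φ : E), ?_⟩⟩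
      rw [ContinuousLinearMap.coe_coe, map_neg]
      exact (eq_neg_of_add_eq_zero_left h).symm
    rwa [T.domain_inf_range, Submodule.mem_bot] at hm
  have h2 : f = 0 := by
    have e : (⟨T.A₀inv f, T.A₀inv_mem f⟩ : T.A₀.domain) = 0 := Subtype.ext h1
    rw [← T.A₀_A₀inv f, e, LinearPMap.map_zero]
  have h3 : (φ : E) = 0 := by
    rw [h1, zero_add] at h
    have : (φ : E) ∈ LinearMap.ker T.Pi.toLinearMap := h
    rwa [T.ker_Pi, Submodule.mem_bot] at this
  exact Prod.ext h2 (Subtype.ext h3)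

/-- `{A₀⁻¹ f + Π φ : f ∈ H, φ ∈ D} = dom A₀ + Π D`. -/
theorem range_compose (D : Submodule ℂ E) :
    LinearMap.range (T.compose D) = T.A₀.domain ⊔ D.map T.Pi.toLinearMap := by
  ext u
  rw [Submodule.mem_sup]
  constructor
  · rintro ⟨⟨f, φ⟩, rfl⟩
    exact ⟨_, T.A₀inv_mem f, _, ⟨φ, φ.2, rfl⟩, rfl⟩
  · rintro ⟨a, ha, _, ⟨φ, hφ, rfl⟩, rfl⟩
    refine ⟨(T.A₀ ⟨a, ha⟩, ⟨φ, hφ⟩), ?_⟩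
    rw [compose_apply, T.A₀inv_A₀]
    rfl

/-- The operator `A₀⁻¹ f + Π φ ↦ S (f, φ)` with domain
`{A₀⁻¹ f + Π φ : f ∈ H, φ ∈ D} = dom A₀ + Π D`. -/
def ofDecomposition {F : Type*} [AddCommGroup F] [Module ℂ F] (D : Submodule ℂ E)
    (S : (H × D) →ₗ[ℂ] F) : H →ₗ.[ℂ] F where
  domain := LinearMap.range (T.compose D)
  toFun := S ∘ₗ (LinearEquiv.ofInjective (T.compose D) (T.compose_injective D)).symm.toLinearMap

theorem ofDecomposition_apply {F : Type*} [AddCommGroup F] [Module ℂ F] (D : Submodule ℂ E)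
    (S : (H × D) →ₗ[ℂ] F) (p : H × D) (h : T.compose D p ∈ (T.ofDecomposition D S).domain) :
    T.ofDecomposition D S ⟨T.compose D p, h⟩ = S p := by
  change S ((LinearEquiv.ofInjective (T.compose D) (T.compose_injective D)).symm
    ⟨T.compose D p, h⟩) = S p
  congr 1
  rw [LinearEquiv.symm_apply_eq]
  rfl

/-- The operator `A : A₀⁻¹ f + Π φ ↦ f`, on `dom A₀ + ran Π`. -/
def A : H →ₗ.[ℂ] H := T.ofDecomposition ⊤ (LinearMap.fst ℂ H (⊤ : Submodule ℂ E))

/-- The boundary operator `Γ₀ : A₀⁻¹ f + Π φ ↦ φ`, on `dom A₀ + ran Π`. -/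
def Γ₀ : H →ₗ.[ℂ] E :=
  T.ofDecomposition ⊤ ((⊤ : Submodule ℂ E).subtype ∘ₗ LinearMap.snd ℂ H (⊤ : Submodule ℂ E))

/-- The boundary operator `Γ₁ : A₀⁻¹ f + Π φ ↦ Π* f + Λ φ`, on `dom A₀ + Π dom Λ`. -/
def Γ₁ : H →ₗ.[ℂ] E :=
  T.ofDecomposition T.Lam.domain
    (T.Pi.adjoint.toLinearMap ∘ₗ LinearMap.fst ℂ H T.Lam.domain +
      T.Lam.toFun ∘ₗ LinearMap.snd ℂ H T.Lam.domain)

theorem range_compose_mono {D D' : Submodule ℂ E} (h : D ≤ D') :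
    LinearMap.range (T.compose D) ≤ LinearMap.range (T.compose D') := by
  rw [range_compose, range_compose]
  exact sup_le_sup_left (Submodule.map_mono h) _

theorem Γ₁_domain_le_A : T.Γ₁.domain ≤ T.A.domain := T.range_compose_mono le_top

theorem Γ₁_domain_le_Γ₀ : T.Γ₁.domain ≤ T.Γ₀.domain := T.range_compose_mono le_top

/-- The solution operator `γ(z) = (I + z (A₀ - z I)⁻¹) Π`. -/
def γ (z : ℂ) : E →L[ℂ] H := T.Pi + z • (resolventOp T.A₀ z ∘L T.Pi)

/-- For `z ∈ ρ(A₀)`, `u = γ(z) φ` solves the problem `A u = z u`, `Γ₀ u = φ`. -/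
theorem γ_spec {z : ℂ} (hz : z ∈ resolventSetOp T.A₀) (φ : E) :
    ∃ (h : T.γ z φ ∈ T.A.domain) (h' : T.γ z φ ∈ T.Γ₀.domain),
      T.A ⟨T.γ z φ, h⟩ = z • T.γ z φ ∧ T.Γ₀ ⟨T.γ z φ, h'⟩ = φ := by
  obtain ⟨hm, he⟩ := (boundedInverse_spec hz).2 (T.Pi φ)
  set r := boundedInverse (subScalar T.A₀ z) (T.Pi φ) with hr
  have hm' : r ∈ T.A₀.domain := hm
  have he' : T.A₀ ⟨r, hm'⟩ - z • r = T.Pi φ := he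
  have key : T.γ z φ = T.compose ⊤ (z • T.γ z φ, ⟨φ, trivial⟩) := by
    rw [compose_apply]
    have e1 : T.γ z φ = T.Pi φ + z • r := rfl
    have e3 : T.A₀ ⟨r, hm'⟩ = T.γ z φ := by rw [e1, ← he']; abel
    rw [← e3, map_smul, T.A₀inv_A₀, e3, e1, add_comm]
  have hA : T.compose ⊤ (z • T.γ z φ, ⟨φ, trivial⟩) ∈
      LinearMap.range (T.compose (⊤ : Submodule ℂ E)) := ⟨_, rfl⟩
  have hmem : T.γ z φ ∈ LinearMap.range (T.compose (⊤ : Submodule ℂ E)) := by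
    rw [key]; exact hA
  have h1 := T.ofDecomposition_apply ⊤ (LinearMap.fst ℂ H (⊤ : Submodule ℂ E))
    (z • T.γ z φ, ⟨φ, trivial⟩) hA
  have h2 := T.ofDecomposition_apply ⊤
    ((⊤ : Submodule ℂ E).subtype ∘ₗ LinearMap.snd ℂ H (⊤ : Submodule ℂ E))
    (z • T.γ z φ, ⟨φ, trivial⟩) hA
  have e : (⟨T.compose ⊤ (z • T.γ z φ, ⟨φ, trivial⟩), hA⟩ :
      LinearMap.range (T.compose (⊤ : Submodule ℂ E))) = ⟨T.γ z φ, hmem⟩ := Subtype.ext key.symm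
  exact ⟨hmem, hmem, (congrArg (fun y => T.A y) e).symm.trans h1,
    (congrArg (fun y => T.Γ₀ y) e).symm.trans h2⟩

theorem resolvent_A₀_mem (z : ℂ) (u : H) : resolventOp T.A₀ z u ∈ T.A₀.domain := by
  by_cases h : z ∈ resolventSetOp T.A₀
  · exact ((boundedInverse_spec h).2 u).1
  · rw [resolventOp, boundedInverse_of_not h]
    exact T.A₀.domain.zero_mem

theorem γ_mem (z : ℂ) (φ : T.Lam.domain) : T.γ z φ ∈ T.Γ₁.domain := by
  change T.γ z φ ∈ LinearMap.range (T.compose T.Lam.domain)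
  rw [range_compose, γ, add_comm]
  exact Submodule.add_mem_sup (Submodule.smul_mem _ _ (T.resolvent_A₀_mem z _)) ⟨φ, φ.2, rfl⟩

/-- The `M`-function: the operator `M(z) = Γ₁ γ(z)` in `E`, with domain `dom Λ`. -/
def M (z : ℂ) : E →ₗ.[ℂ] E :=
  T.Γ₁.comp ((T.γ z).toLinearMap.toPMap T.Lam.domain) (fun φ => T.γ_mem z φ)

/-- The closure `ß` of the operator `α + β Λ`. -/
def bdryClosure (α : E →ₗ.[ℂ] E) (β : E →L[ℂ] E) : E →ₗ.[ℂ] E :=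
  (α + β.toLinearMap.compPMap T.Lam).closure

/-- The operator `α Γ₀ + β Γ₁ : A₀⁻¹ f + Π φ ↦ β Π* f + ß φ`, on `dom A₀ + Π dom ß`. -/
def bdryOperator (α : E →ₗ.[ℂ] E) (β : E →L[ℂ] E) : H →ₗ.[ℂ] E :=
  T.ofDecomposition (T.bdryClosure α β).domain
    (β.toLinearMap ∘ₗ T.Pi.adjoint.toLinearMap ∘ₗ LinearMap.fst ℂ H _ +
      (T.bdryClosure α β).toFun ∘ₗ LinearMap.snd ℂ H _)

/-- The operator `A_{αβ}` of the boundary-value problem with boundary condition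
`(α Γ₀ + β Γ₁) u = 0`: the restriction of `A` to the kernel of `α Γ₀ + β Γ₁`. -/
def bvpOperator (α : E →ₗ.[ℂ] E) (β : E →L[ℂ] E) : H →ₗ.[ℂ] H :=
  T.A.domRestrict
    ((LinearMap.ker (T.bdryOperator α β).toFun).map (T.bdryOperator α β).domain.subtype)

/-- The dissipative operator `L = A_{-iI, I}`. -/
def L : H →ₗ.[ℂ] H :=
  T.bvpOperator ((-Complex.I • LinearMap.id (R := ℂ) (M := E)).toPMap ⊤)
    (ContinuousLinearMap.id ℂ E)

/-- The characteristic function `S(z) = (M(z) - i I)(M(z) + i I)⁻¹ = I - 2i (M(z) + i I)⁻¹`. -/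
def S (z : ℂ) : E →L[ℂ] E :=
  ContinuousLinearMap.id ℂ E -
    (2 * Complex.I) • boundedInverse (subScalar (T.M z) (-Complex.I))

theorem S_apply {z : ℂ} (hz : HasBoundedInverse (subScalar (T.M z) (-Complex.I))) (e : E) :
    ∃ h : boundedInverse (subScalar (T.M z) (-Complex.I)) e ∈
        (subScalar (T.M z) Complex.I).domain,
      subScalar (T.M z) Complex.I ⟨_, h⟩ = T.S z e := by
  obtain ⟨h, he⟩ := (boundedInverse_spec hz).2 e
  set x := boundedInverse (subScalar (T.M z) (-Complex.I)) e with hx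
  have h' : x ∈ (T.M z).domain := h
  have he' : T.M z ⟨x, h'⟩ - (-Complex.I) • x = e := he
  refine ⟨h, ?_⟩
  change T.M z ⟨x, h'⟩ - Complex.I • x = e - (2 * Complex.I) • x
  rw [← he', mul_smul, two_smul, neg_smul]
  abel

variable (H E) in
/-- The Hilbert space `L²(ℝ₋, E) ⊕ H ⊕ L²(ℝ₊, E)`. -/
abbrev DilationSpace : Type _ :=
  WithLp 2 (L2 E (Iio 0) × WithLp 2 (H × L2 E (Ioi 0)))

/-- The element `(vm, u, vp)` of `L²(ℝ₋, E) ⊕ H ⊕ L²(ℝ₊, E)`. -/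
abbrev triple (vm : L2 E (Iio 0)) (u : H) (vp : L2 E (Ioi 0)) : DilationSpace H E :=
  WithLp.toLp 2 (vm, WithLp.toLp 2 (u, vp))

/-- The domain of the dilation: the triples `(vm, u, vp)` with `vm ∈ W¹₂(ℝ₋, E)`,
`vp ∈ W¹₂(ℝ₊, E)`, `u ∈ dom Γ₁`, `Γ₁ u + i Γ₀ u = √2 vp(0)` and `Γ₁ u - i Γ₀ u = √2 vm(0)`. -/
def dilationDomain : Submodule ℂ (DilationSpace H E) where
  carrier := {x | x.fst ∈ W12 E (Iio 0) ∧ x.snd.snd ∈ W12 E (Ioi 0) ∧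
    ∃ (hu : x.snd.fst ∈ T.Γ₁.domain) (em ep : E),
      HasBoundaryValue x.fst em ∧ HasBoundaryValue x.snd.snd ep ∧
      T.Γ₁ ⟨x.snd.fst, hu⟩ + Complex.I • T.Γ₀ ⟨x.snd.fst, T.Γ₁_domain_le_Γ₀ hu⟩ =
        ((√2 : ℝ) : ℂ) • ep ∧
      T.Γ₁ ⟨x.snd.fst, hu⟩ - Complex.I • T.Γ₀ ⟨x.snd.fst, T.Γ₁_domain_le_Γ₀ hu⟩ =
        ((√2 : ℝ) : ℂ) • em}
  zero_mem' := by
    refine ⟨zero_mem _, zero_mem _, zero_mem _, 0, 0, HasBoundaryValue.zero,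
      HasBoundaryValue.zero, ?_, ?_⟩
    · have h1 : T.Γ₁ ⟨0, zero_mem _⟩ = 0 := T.Γ₁.map_zero
      have h2 : T.Γ₀ ⟨0, zero_mem _⟩ = 0 := T.Γ₀.map_zero
      simp [h1, h2]
    · have h1 : T.Γ₁ ⟨0, zero_mem _⟩ = 0 := T.Γ₁.map_zero
      have h2 : T.Γ₀ ⟨0, zero_mem _⟩ = 0 := T.Γ₀.map_zero
      simp [h1, h2]
  add_mem' := by
    rintro x y ⟨h1, h2, hu, a, b, ha, hb, e1, e2⟩ ⟨h1', h2', hu', a', b', ha', hb', e1', e2'⟩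
    have k1 : T.Γ₁ ⟨x.snd.fst + y.snd.fst, add_mem hu hu'⟩ = _ :=
      T.Γ₁.map_add ⟨_, hu⟩ ⟨_, hu'⟩
    have k0 : T.Γ₀ ⟨x.snd.fst + y.snd.fst, T.Γ₁_domain_le_Γ₀ (add_mem hu hu')⟩ = _ :=
      T.Γ₀.map_add ⟨_, T.Γ₁_domain_le_Γ₀ hu⟩ ⟨_, T.Γ₁_domain_le_Γ₀ hu'⟩
    refine ⟨add_mem h1 h1', add_mem h2 h2', add_mem hu hu', a + a', b + b', ha.add ha',
      hb.add hb', ?_, ?_⟩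
    · simp only [WithLp.add_snd, WithLp.add_fst]
      rw [k1, k0, smul_add, smul_add, ← e1, ← e1']
      abel
    · simp only [WithLp.add_snd, WithLp.add_fst]
      rw [k1, k0, smul_add, smul_add, ← e2, ← e2']
      abel
  smul_mem' := by
    rintro c x ⟨h1, h2, hu, a, b, ha, hb, e1, e2⟩
    have k1 : T.Γ₁ ⟨c • x.snd.fst, Submodule.smul_mem _ c hu⟩ = _ := T.Γ₁.map_smul c ⟨_, hu⟩
    have k0 : T.Γ₀ ⟨c • x.snd.fst, T.Γ₁_domain_le_Γ₀ (Submodule.smul_mem _ c hu)⟩ = _ :=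
      T.Γ₀.map_smul c ⟨_, T.Γ₁_domain_le_Γ₀ hu⟩
    refine ⟨Submodule.smul_mem _ c h1, Submodule.smul_mem _ c h2, Submodule.smul_mem _ c hu,
      c • a, c • b, ha.smul c, hb.smul c, ?_, ?_⟩
    · simp only [WithLp.smul_snd, WithLp.smul_fst]
      rw [k1, k0, smul_comm _ c b, ← e1, smul_add, smul_comm c]
    · simp only [WithLp.smul_snd, WithLp.smul_fst]
      rw [k1, k0, smul_comm _ c a, ← e2, smul_sub, smul_comm c]

/-- The operator `(vm, u, vp) ↦ (i vm', A u, i vp')` on the domain `dilationDomain`. -/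
def dilation : DilationSpace H E →ₗ.[ℂ] DilationSpace H E where
  domain := T.dilationDomain
  toFun :=
    { toFun := fun x => triple
        (Complex.I • sobolevDeriv E (Iio 0) ⟨(x : DilationSpace H E).fst, x.2.1⟩)
        (T.A ⟨(x : DilationSpace H E).snd.fst, T.Γ₁_domain_le_A x.2.2.2.1⟩)
        (Complex.I • sobolevDeriv E (Ioi 0) ⟨(x : DilationSpace H E).snd.snd, x.2.2.1⟩)
      map_add' := by
        intro x y
        have k1 := (sobolevDeriv E (Iio 0)).map_add ⟨_, x.2.1⟩ ⟨_, y.2.1⟩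
        have k2 := T.A.map_add ⟨_, T.Γ₁_domain_le_A x.2.2.2.1⟩ ⟨_, T.Γ₁_domain_le_A y.2.2.2.1⟩
        have k3 := (sobolevDeriv E (Ioi 0)).map_add ⟨_, x.2.2.1⟩ ⟨_, y.2.2.1⟩
        refine WithLp.ofLp_injective 2 (Prod.ext ?_ (WithLp.ofLp_injective 2 (Prod.ext ?_ ?_)))
        · exact (congrArg (fun w => Complex.I • w) k1).trans (smul_add _ _ _)
        · exact k2
        · exact (congrArg (fun w => Complex.I • w) k3).trans (smul_add _ _ _)
      map_smul' := by
        intro c x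
        have k1 := (sobolevDeriv E (Iio 0)).map_smul c ⟨_, x.2.1⟩
        have k2 := T.A.map_smul c ⟨_, T.Γ₁_domain_le_A x.2.2.2.1⟩
        have k3 := (sobolevDeriv E (Ioi 0)).map_smul c ⟨_, x.2.2.1⟩
        refine WithLp.ofLp_injective 2 (Prod.ext ?_ (WithLp.ofLp_injective 2 (Prod.ext ?_ ?_)))
        · exact (congrArg (fun w => Complex.I • w) k1).trans (smul_comm _ _ _)
        · exact k2
        · exact (congrArg (fun w => Complex.I • w) k3).trans (smul_comm _ _ _) }

end RyzhovTriple

end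

open UnboundedOp

/-! Everything reduces to explicitly solvable boundary-value problems, tied together by Green's
formulas. In `H`, symmetry of `A₀⁻¹` and `Λ` gives `Im ⟨u, A u⟩ = Im ⟨Γ₀ u, Γ₁ u⟩` on `dom Γ₁`
(`BoundaryData.green`, `BoundaryData.inner_im`). On the half-lines, `2 Re ⟨v, v'⟩ = ∓‖v(0)‖²` for
`ℝ₊` and `ℝ₋` respectively (`green_Ioi`, `green_Iio`). Since `‖Γ₁u + iΓ₀u‖² - ‖Γ₁u - iΓ₀u‖² = 4 Im
⟨Γ₀u, Γ₁u⟩`, the conditions coupling the three components make all boundary terms cancel, and `𝒜` is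
symmetric.

Solvability in `H` rests on `M(z) = Λ + z Π* γ(z)`, a bounded perturbation of a self-adjoint
operator with `Im ⟨e, M(z) e⟩ = Im z ‖γ(z) e‖²`. Hence `M(z) - w` is boundedly invertible when `z`
and `w` lie in opposite half-planes, and a Krein-type formula solves `(A - z) u = h`, `Γ₁ u - w Γ₀ u
= b`. With `w = i`, `b = 0` this is the resolvent of `L` for `Im z < 0`; its adjoint at the
conjugate point is the same formula with `w = -i`, which is the resolvent of `L*`.

For `Im z < 0` the component on `ℝ₋` is determined by its own equation, because `e^{-izx}` is not
square-integrable there. Its value at `0` supplies `b`, and the remaining boundary condition fixes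
the multiple of `e^{-izx}` to be added on `ℝ₊`. For `Im z > 0` the half-lines exchange roles. So `𝒜
- z` is onto for every non-real `z`; being symmetric, `𝒜` is self-adjoint, and the constructed
solution is its resolvent. The dilation property is the case of zero data on both half-lines. -/

namespace UnboundedOp

/-! ### Bounded inverses from lower bounds -/

section Banach

variable {V W : Type*} [NormedAddCommGroup V] [NormedSpace ℂ V]
  [NormedAddCommGroup W] [NormedSpace ℂ W]

theorem subScalar_apply (T : V →ₗ.[ℂ] V) (z : ℂ) (x : V) (h : x ∈ (subScalar T z).domain)
    (h' : x ∈ T.domain) : subScalar T z ⟨x, h⟩ = T ⟨x, h'⟩ - z • x := rfl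

theorem boundedInverse_eq {T : V →ₗ.[ℂ] W} {R : W →L[ℂ] V} (h : IsBoundedInverse T R) :
    boundedInverse T = R :=
  (boundedInverse_spec ⟨R, h⟩).unique h

/-- A surjective operator that is bounded below is boundedly invertible. -/
theorem HasBoundedInverse.of_surjective {T : V →ₗ.[ℂ] W} {c : ℝ} (hc : 0 < c)
    (hb : ∀ x : T.domain, c * ‖(x : V)‖ ≤ ‖T x‖) (hs : ∀ y, ∃ x, T x = y) :
    HasBoundedInverse T := by
  choose g hg using hs
  have hinj : ∀ x x' : T.domain, T x = T x' → x = x' := by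
    intro x x' h
    have h1 := hb (x - x')
    rw [T.map_sub, h, sub_self, norm_zero] at h1
    have h2 : ‖((x - x' : T.domain) : V)‖ ≤ 0 := by
      by_contra! h3
      nlinarith [mul_pos hc h3]
    have h4 : ((x - x' : T.domain) : V) = 0 := norm_le_zero_iff.1 h2
    exact sub_eq_zero.1 (Subtype.ext h4)
  let R : W →ₗ[ℂ] V :=
    { toFun := fun y => g y
      map_add' := fun y y' => by
        have : g (y + y') = g y + g y' := hinj _ _ (by rw [T.map_add, hg, hg, hg])
        rw [this]; rfl
      map_smul' := fun a y => by
        have : g (a • y) = a • g y := hinj _ _ (by rw [T.map_smul, hg, hg])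
        rw [this]; rfl }
  have hR : ∀ y, ‖R y‖ ≤ c⁻¹ * ‖y‖ := by
    intro y
    have h := hb (g y)
    rw [hg] at h
    rw [inv_mul_eq_div, le_div_iff₀ hc, mul_comm]
    exact h
  refine ⟨R.mkContinuous c⁻¹ hR, fun x => ?_, fun y => ⟨(g y).2, hg y⟩⟩
  exact congrArg Subtype.val (hinj (g (T x)) x (hg _))

end Banach

/-! ### Dissipative, symmetric and self-adjoint operators -/

section Hilbert

variable {V : Type*} [NormedAddCommGroup V] [InnerProductSpace ℂ V]

/-- The lower bound makes preimages of a convergent sequence Cauchy, so a closed graph forces a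
closed range; a closed subspace with trivial orthogonal complement is the whole space. -/
theorem surjective_of_isClosed [CompleteSpace V] {T : V →ₗ.[ℂ] V} {c : ℝ} (hc : 0 < c)
    (hb : ∀ x : T.domain, c * ‖(x : V)‖ ≤ ‖T x‖) (hT : T.IsClosed)
    (hd : ∀ y : V, (∀ x : T.domain, inner ℂ y (T x) = 0) → y = 0) (y : V) :
    ∃ x, T x = y := by
  have hcl : IsClosed (LinearMap.range T.toFun : Set V) := by
    rw [← isSeqClosed_iff_isClosed]
    intro u l hu hl
    choose x hx using hu
    have hcauchy : CauchySeq fun n => (x n : V) := by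
      rw [Metric.cauchySeq_iff']
      intro ε hε
      obtain ⟨N, hN⟩ := Metric.cauchySeq_iff'.1 hl.cauchySeq (c * ε) (by positivity)
      refine ⟨N, fun n hn => ?_⟩
      have h1 := hb (x n - x N)
      have h2 := hN n hn
      rw [dist_eq_norm, ← hx, ← hx] at h2
      rw [T.map_sub] at h1
      rw [dist_eq_norm]
      have h3 : c * ‖(x n : V) - x N‖ < c * ε := lt_of_le_of_lt h1 h2
      exact lt_of_mul_lt_mul_left h3 hc.le
    obtain ⟨a, ha⟩ := cauchySeq_tendsto_of_complete hcauchy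
    have hmem : (a, l) ∈ T.graph := by
      refine hT.mem_of_tendsto (ha.prodMk_nhds hl) (Filter.Eventually.of_forall fun n => ?_)
      rw [← hx]
      exact T.mem_graph (x n)
    obtain ⟨b, hb1, hb2⟩ := (LinearPMap.mem_graph_iff T).1 hmem
    exact ⟨b, hb2⟩
  have : CompleteSpace (LinearMap.range T.toFun) := hcl.completeSpace_coe
  have htop : LinearMap.range T.toFun = ⊤ := by
    rw [← Submodule.orthogonal_eq_bot_iff, Submodule.eq_bot_iff]
    intro y hy
    refine hd y fun x => ?_
    exact (Submodule.mem_orthogonal' _ _).1 hy _ ⟨x, rfl⟩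
  exact LinearMap.range_eq_top.1 htop y

theorem bound_of_abs_im {x y : V} {c : ℝ} (h : c * ‖x‖ ^ 2 ≤ |(inner ℂ x y).im|) :
    c * ‖x‖ ≤ ‖y‖ := by
  have h1 : c * ‖x‖ ^ 2 ≤ ‖x‖ * ‖y‖ :=
    h.trans ((Complex.abs_im_le_norm _).trans (norm_inner_le_norm x y))
  rcases (norm_nonneg x).eq_or_lt with h0 | h0
  · rw [← h0, mul_zero]
    exact norm_nonneg y
  · nlinarith

/-- Besides producing lower bounds for `T - z`, this is used with `y = 0` to evaluate `Im ⟨x, z x⟩`.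
-/
theorem inner_sub_smul_im (x y : V) (z : ℂ) :
    (inner ℂ x (y - z • x)).im = (inner ℂ x y).im - z.im * ‖x‖ ^ 2 := by
  rw [inner_sub_right, inner_smul_right, inner_self_eq_norm_sq_to_K, Complex.sub_im,
    Complex.mul_im]
  have : ((‖x‖ : ℂ) ^ 2) = ((‖x‖ ^ 2 : ℝ) : ℂ) := by push_cast; rfl
  change (inner ℂ x y).im - (z.re * ((‖x‖ : ℂ) ^ 2).im + z.im * ((‖x‖ : ℂ) ^ 2).re) = _
  rw [this, Complex.ofReal_re, Complex.ofReal_im]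
  ring

/-- A dissipative operator with a point of the lower half-plane in its resolvent set is densely
defined. -/
theorem dense_of_dissipative [CompleteSpace V] {L : V →ₗ.[ℂ] V}
    (hL : ∀ u : L.domain, 0 ≤ (inner ℂ (u : V) (L u)).im) {z : ℂ} (hz : z.im < 0)
    (hs : ∀ y, ∃ x, subScalar L z x = y) : Dense (L.domain : Set V) := by
  rw [Submodule.dense_iff_topologicalClosure_eq_top,
    Submodule.topologicalClosure_eq_top_iff, Submodule.eq_bot_iff]
  intro g hg
  obtain ⟨x, hx⟩ := hs g
  have h1 : inner ℂ (x : V) g = 0 := (Submodule.mem_orthogonal _ _).1 hg _ x.2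
  have h2 := inner_sub_smul_im (x : V) (L ⟨x, x.2⟩) z
  have h3 : L ⟨x, x.2⟩ - z • (x : V) = g := hx
  rw [h3, h1, Complex.zero_im] at h2
  have h4 := hL ⟨x, x.2⟩
  have h5 : ‖(x : V)‖ ^ 2 ≤ 0 := by
    by_contra! h6
    nlinarith [mul_pos_of_neg_of_neg hz (neg_neg_of_pos h6)]
  have h6 : (x : V) = 0 := by
    have : ‖(x : V)‖ = 0 := by nlinarith [norm_nonneg (x : V)]
    exact norm_eq_zero.1 this
  have h7 : x = 0 := Subtype.ext h6
  rw [← hx, h7, LinearPMap.map_zero]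

theorem HasBoundedInverse.of_symmetric {D : V →ₗ.[ℂ] V}
    (hD : ∀ x : D.domain, (inner ℂ (x : V) (D x)).im = 0) {z : ℂ} (hz : z.im ≠ 0)
    (hs : ∀ y, ∃ x, subScalar D z x = y) : z ∈ resolventSetOp D := by
  refine HasBoundedInverse.of_surjective (abs_pos.2 hz) (fun x => bound_of_abs_im ?_) hs
  have h := inner_sub_smul_im (x : V) (D ⟨x, x.2⟩) z
  rw [hD ⟨x, x.2⟩, zero_sub] at h
  have h' : (inner ℂ (x : V) (subScalar D z x)).im = -(z.im * ‖(x : V)‖ ^ 2) := h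
  rw [h', abs_neg, abs_mul, abs_of_nonneg (sq_nonneg ‖(x : V)‖)]

/-- Polarization: the quadratic form at `x + y` gives the imaginary parts, and replacing `y` by `i
y` gives the real parts. -/
theorem inner_symm_of_im_eq_zero {D : V →ₗ.[ℂ] V}
    (hD : ∀ x : D.domain, (inner ℂ (x : V) (D x)).im = 0) (x y : D.domain) :
    inner ℂ (D x) (y : V) = inner ℂ (x : V) (D y) := by
  have key : ∀ a b : D.domain,
      (inner ℂ (a : V) (D b)).im + (inner ℂ (b : V) (D a)).im = 0 := by
    intro a b
    have h := hD (a + b)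
    rw [D.map_add, Submodule.coe_add, inner_add_left, inner_add_right, inner_add_right,
      Complex.add_im, Complex.add_im, Complex.add_im, hD a, hD b] at h
    linarith
  have h1 := key x y
  have h2 := key x (Complex.I • y)
  rw [D.map_smul, Submodule.coe_smul, inner_smul_right, inner_smul_left] at h2
  simp only [Complex.conj_I, Complex.mul_im, Complex.I_re, Complex.I_im, Complex.neg_re,
    Complex.neg_im] at h2
  rw [← inner_conj_symm]
  apply Complex.ext
  · rw [Complex.conj_re]; linarith
  · rw [Complex.conj_im]; linarith

/-- A symmetric operator `D` such that `D - z` is onto for all non-real `z` is self-adjoint. -/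
theorem isSelfAdjoint_of_surjective [CompleteSpace V] {D : V →ₗ.[ℂ] V}
    (hD : ∀ x : D.domain, (inner ℂ (x : V) (D x)).im = 0)
    (hs : ∀ z : ℂ, z.im ≠ 0 → ∀ y, ∃ x, subScalar D z x = y) : IsSelfAdjoint D := by
  have hI : (-Complex.I).im < 0 := by simp
  have hI' : (Complex.I).im ≠ 0 := by simp
  have hd : Dense (D.domain : Set V) :=
    dense_of_dissipative (fun u => (hD u).ge) hI (hs _ hI.ne)
  have hsymm : D.IsFormalAdjoint D := inner_symm_of_im_eq_zero hD
  have hle : D ≤ D.adjoint := hsymm.le_adjoint hd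
  rw [LinearPMap.isSelfAdjoint_def]
  refine (LinearPMap.eq_of_le_of_domain_eq hle (le_antisymm hle.1 fun y hy => ?_)).symm
  -- With `(D + i) x = (D* + i) y`, the difference `x - y` is orthogonal to the range of `D - i`,
  -- which is everything; so `y = x` lies in `dom D`.
  obtain ⟨x, hx⟩ := hs (-Complex.I) hI.ne (D.adjoint ⟨y, hy⟩ - (-Complex.I) • y)
  have hx' : D ⟨x, x.2⟩ - (-Complex.I) • (x : V) = D.adjoint ⟨y, hy⟩ - (-Complex.I) • y := hx
  have h0 : ∀ g : V, inner ℂ ((x : V) - y) g = 0 := by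
    intro g
    obtain ⟨u, hu⟩ := hs Complex.I hI' g
    have hu' : D ⟨u, u.2⟩ - Complex.I • (u : V) = g := hu
    have e1 := hsymm ⟨x, x.2⟩ ⟨u, u.2⟩
    have e2 := LinearPMap.adjoint_isFormalAdjoint hd ⟨y, hy⟩ ⟨u, u.2⟩
    have e3 : inner ℂ (D ⟨x, x.2⟩ - (-Complex.I) • (x : V)) (u : V) =
        inner ℂ (D.adjoint ⟨y, hy⟩ - (-Complex.I) • y) (u : V) := by rw [hx']
    simp only [inner_sub_left, inner_smul_left, e1, e2, map_neg, Complex.conj_I] at e3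
    rw [← hu', inner_sub_left, inner_sub_right, inner_sub_right, inner_smul_right,
      inner_smul_right]
    linear_combination e3
  have h1 : (x : V) - y = 0 := inner_self_eq_zero.1 (h0 _)
  rw [← sub_eq_zero.1 h1]
  exact x.2

theorem inner_symm_of_isSelfAdjoint [CompleteSpace V] {T : V →ₗ.[ℂ] V} (hT : IsSelfAdjoint T)
    (x y : T.domain) : inner ℂ (T x) (y : V) = inner ℂ (x : V) (T y) := by
  have h := LinearPMap.adjoint_isFormalAdjoint hT.dense_domain
  rw [LinearPMap.isSelfAdjoint_def.1 hT] at h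
  exact h x y

theorem inner_im_of_isSelfAdjoint [CompleteSpace V] {T : V →ₗ.[ℂ] V} (hT : IsSelfAdjoint T)
    (x : T.domain) : (inner ℂ (x : V) (T x)).im = 0 := by
  have h := inner_symm_of_isSelfAdjoint hT x x
  rw [← inner_conj_symm] at h
  exact Complex.conj_eq_iff_im.1 h

theorem mem_domain_of_isSelfAdjoint [CompleteSpace V] {T : V →ₗ.[ℂ] V} (hT : IsSelfAdjoint T)
    {y w : V} (h : ∀ x : T.domain, inner ℂ y (T x) = inner ℂ w (x : V)) :
    ∃ hy : y ∈ T.domain, T ⟨y, hy⟩ = w := by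
  have h1 : y ∈ T.adjoint.domain :=
    LinearPMap.mem_adjoint_domain_of_exists y ⟨w, fun x => (h x).symm⟩
  have h2 := LinearPMap.adjoint_apply_eq hT.dense_domain ⟨y, h1⟩ (x₀ := w)
    fun x => (h x).symm
  have e := LinearPMap.isSelfAdjoint_def.1 hT
  have h3 : y ∈ T.domain := e.le.1 h1
  exact ⟨h3, (e.le.2 (x := ⟨y, h1⟩) (y := ⟨y, h3⟩) rfl).symm.trans h2⟩

/-- The sum of a self-adjoint operator `T` and a bounded operator `B` is boundedly invertible if
it is definite in the sense that `|Im ⟨(T + B) x, x⟩| ≥ c ‖x‖²`, which also controls the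
adjoint `T + B*`. -/
theorem HasBoundedInverse.of_isSelfAdjoint_add [CompleteSpace V] {T S : V →ₗ.[ℂ] V}
    (hT : IsSelfAdjoint T) (B : V →L[ℂ] V) (hS : S.domain = T.domain)
    (hS' : ∀ x (h : x ∈ S.domain) (h' : x ∈ T.domain), S ⟨x, h⟩ = T ⟨x, h'⟩ + B x)
    {c : ℝ} (hc : 0 < c) (hB : ∀ x, c * ‖x‖ ^ 2 ≤ |(inner ℂ x (B x)).im|) :
    HasBoundedInverse S := by
  have hb : ∀ x : S.domain, c * ‖(x : V)‖ ≤ ‖S x‖ := by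
    intro x
    have hx : (x : V) ∈ T.domain := hS ▸ x.2
    refine bound_of_abs_im ?_
    have e : S x = T ⟨x, hx⟩ + B x := hS' x x.2 hx
    rw [e, inner_add_right, Complex.add_im, inner_im_of_isSelfAdjoint hT ⟨x, hx⟩, zero_add]
    exact hB x
  refine HasBoundedInverse.of_surjective hc hb (surjective_of_isClosed hc hb ?_ ?_)
  · have hcl : IsClosed (T.graph : Set (V × V)) := hT.isClosed
    -- The graph of `T + B` is a continuous preimage of the closed graph of `T`.
    have e : (S.graph : Set (V × V)) = (fun p : V × V => (p.1, p.2 - B p.1)) ⁻¹' T.graph := by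
      ext p
      simp only [SetLike.mem_coe, LinearPMap.mem_graph_iff, mem_preimage]
      constructor
      · rintro ⟨x, h1, h2⟩
        have hx : (x : V) ∈ T.domain := hS ▸ x.2
        refine ⟨⟨x, hx⟩, h1, ?_⟩
        rw [← h2, ← h1, show S x = _ from hS' x x.2 hx, add_sub_cancel_right]
      · rintro ⟨x, h1, h2⟩
        have hx : (x : V) ∈ S.domain := by rw [hS]; exact x.2
        refine ⟨⟨x, hx⟩, h1, ?_⟩
        rw [hS' x hx x.2, h2, h1, sub_add_cancel]
    change IsClosed (S.graph : Set (V × V))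
    rw [e]
    exact hcl.preimage (by fun_prop)
  · intro y hy
    -- A vector orthogonal to the range lies in `dom T` with `T y = -B* y`. As `⟨y, T y⟩` is real,
    -- `Im ⟨y, B y⟩` vanishes, and definiteness gives `y = 0`.
    obtain ⟨h1, h2⟩ := mem_domain_of_isSelfAdjoint hT (y := y) (w := -B.adjoint y) fun x => by
      have hx : (x : V) ∈ S.domain := by rw [hS]; exact x.2
      have h := hy ⟨x, hx⟩
      rw [hS' x hx x.2, inner_add_right] at h
      rw [inner_neg_left, ContinuousLinearMap.adjoint_inner_left]
      exact eq_neg_of_add_eq_zero_left h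
    have h3 := inner_im_of_isSelfAdjoint hT ⟨y, h1⟩
    rw [h2] at h3
    simp only [inner_neg_right, ContinuousLinearMap.adjoint_inner_right, Complex.neg_im,
      neg_eq_zero] at h3
    rw [← inner_conj_symm, Complex.conj_im, neg_eq_zero] at h3
    have h4 := hB y
    rw [h3, abs_zero] at h4
    have h5 : ‖y‖ ^ 2 ≤ 0 := by
      by_contra! h6
      nlinarith [mul_pos hc h6]
    exact norm_eq_zero.1 (by nlinarith [norm_nonneg y])

/-- Non-real points belong to the resolvent set of a self-adjoint operator. -/
theorem mem_resolventSetOp_of_isSelfAdjoint [CompleteSpace V] {T : V →ₗ.[ℂ] V}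
    (hT : IsSelfAdjoint T) {z : ℂ} (hz : z.im ≠ 0) : z ∈ resolventSetOp T := by
  refine HasBoundedInverse.of_isSelfAdjoint_add hT (-(z • ContinuousLinearMap.id ℂ V)) rfl
    (fun x h h' => ?_) (abs_pos.2 hz) (fun x => ?_)
  · rw [subScalar_apply _ _ _ _ h', sub_eq_add_neg]
    rfl
  · have h := inner_sub_smul_im x 0 z
    rw [zero_sub, inner_zero_right, Complex.zero_im, zero_sub] at h
    have h' : (inner ℂ x ((-(z • ContinuousLinearMap.id ℂ V)) x)).im = -(z.im * ‖x‖ ^ 2) := h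
    rw [h', abs_neg, abs_mul, abs_of_nonneg (sq_nonneg ‖x‖)]

/-- Bounded inverses of formally adjoint operators are adjoint to each other. -/
theorem IsBoundedInverse.adjoint_eq [CompleteSpace V] {S T : V →ₗ.[ℂ] V} {R R' : V →L[ℂ] V}
    (hR : IsBoundedInverse S R) (hR' : IsBoundedInverse T R') (h : S.IsFormalAdjoint T) :
    R.adjoint = R' := by
  ext y
  refine ext_inner_left ℂ fun x => ?_
  rw [ContinuousLinearMap.adjoint_inner_right]
  obtain ⟨h1, h2⟩ := hR.2 x
  obtain ⟨h3, h4⟩ := hR'.2 y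
  have := h ⟨R x, h1⟩ ⟨R' y, h3⟩
  rw [h2, h4] at this
  exact this.symm

/-- The resolvent of the adjoint operator. -/
theorem IsBoundedInverse.adjoint [CompleteSpace V] {L : V →ₗ.[ℂ] V}
    (hd : Dense (L.domain : Set V)) {z : ℂ} {R : V →L[ℂ] V}
    (hR : IsBoundedInverse (subScalar L (conj z)) R) :
    IsBoundedInverse (subScalar L.adjoint z) R.adjoint := by
  constructor
  · rintro ⟨y, hy⟩
    have hy' : y ∈ L.adjoint.domain := hy
    rw [subScalar_apply _ _ _ _ hy']
    refine ext_inner_right ℂ fun x => ?_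
    rw [ContinuousLinearMap.adjoint_inner_left]
    obtain ⟨h1, h2⟩ := hR.2 x
    have h1' : R x ∈ L.domain := h1
    rw [subScalar_apply _ _ _ _ h1'] at h2
    have h3 := LinearPMap.adjoint_isFormalAdjoint hd ⟨y, hy'⟩ ⟨R x, h1'⟩
    nth_rewrite 2 [← h2]
    rw [inner_sub_left, inner_smul_left, inner_sub_right, inner_smul_right, h3]
  · intro y
    -- This is `⟨y, x⟩ = ⟨R* y, (L - conj z) x⟩` rearranged; it shows both that `R* y` lies in `dom
    -- L*` and what `L*` does to it.
    have key : ∀ x : L.domain,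
        inner ℂ (y + z • R.adjoint y) (x : V) = inner ℂ (R.adjoint y) (L x) := by
      intro x
      have h1 : R (L x - conj z • (x : V)) = x := hR.1 ⟨x, x.2⟩
      rw [inner_add_left, inner_smul_left]
      simp only [ContinuousLinearMap.adjoint_inner_left]
      rw [map_sub, map_smul, sub_eq_iff_eq_add] at h1
      rw [h1, inner_add_right, inner_smul_right]
    have hmem : R.adjoint y ∈ L.adjoint.domain :=
      LinearPMap.mem_adjoint_domain_of_exists _ ⟨_, key⟩
    refine ⟨hmem, ?_⟩
    change L.adjoint ⟨_, hmem⟩ - z • R.adjoint y = y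
    rw [LinearPMap.adjoint_apply_eq hd ⟨_, hmem⟩ key,
      add_sub_cancel_right]

end Hilbert

end UnboundedOp

/-! ### Integration by parts and test functions -/

namespace HalfLine

section Primitive

variable {E F G : Type*} [NormedAddCommGroup E] [NormedSpace ℝ E] [CompleteSpace E]
  [NormedAddCommGroup F] [NormedSpace ℝ F] [CompleteSpace F]
  [NormedAddCommGroup G] [NormedSpace ℝ G] [CompleteSpace G]

/-- Integration by parts for the primitives of integrable functions that vanish at `a`. -/
theorem setIntegral_bilin_primitive (B : E →L[ℝ] F →L[ℝ] G) {f : ℝ → E} {g : ℝ → F} {a b : ℝ}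
    (hf : IntegrableOn f (Ioc a b)) (hg : IntegrableOn g (Ioc a b)) :
    (∫ x in Ioc a b, B (f x) (∫ t in Ioc a x, g t)) +
      ∫ x in Ioc a b, B (∫ t in Ioc a x, f t) (g x) =
      B (∫ x in Ioc a b, f x) (∫ x in Ioc a b, g x) := by
  set μ := volume.restrict (Ioc a b) with hμ
  have hI : Integrable (fun z : ℝ × ℝ => B (f z.1) (g z.2)) (μ.prod μ) :=
    Integrable.op_fst_snd (op := fun x y => B x y) (by fun_prop) ⟨‖B‖, B.le_opNorm₂⟩ hf hg
  rw [← integral_prod_bilin (𝕜 := ℝ) B hf hg]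
  -- The product of the two integrals is an integral over a square. Cutting along the diagonal and
  -- applying Fubini in a different order on each half yields the two terms.
  have hS : MeasurableSet {z : ℝ × ℝ | z.2 ≤ z.1} := measurableSet_le measurable_snd measurable_fst
  rw [← integral_add_compl hS hI, ← integral_indicator hS, ← integral_indicator hS.compl,
    integral_prod _ (hI.indicator hS), integral_prod_symm _ (hI.indicator hS.compl)]
  congr 1
  · refine setIntegral_congr_fun measurableSet_Ioc fun x hx => ?_
    have e : ∀ y, {z : ℝ × ℝ | z.2 ≤ z.1}.indicator (fun z => B (f z.1) (g z.2)) (x, y) =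
        (Iic x).indicator (fun y => B (f x) (g y)) y := fun y => by
      simp [indicator]
    have e2 : Iic x ∩ Ioc a b = Ioc a x := by
      ext y; simp only [mem_inter_iff, mem_Iic, mem_Ioc] at hx ⊢; grind
    simp only [e]
    rw [integral_indicator measurableSet_Iic, hμ, Measure.restrict_restrict measurableSet_Iic, e2,
      ContinuousLinearMap.integral_comp_comm _ (hg.mono_set (Ioc_subset_Ioc_right hx.2))]
  · refine setIntegral_congr_fun measurableSet_Ioc fun y hy => ?_
    have e : ∀ x, {z : ℝ × ℝ | z.2 ≤ z.1}ᶜ.indicator (fun z => B (f z.1) (g z.2)) (x, y) =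
        (Iio y).indicator (fun x => B.flip (g y) (f x)) x := fun x => by
      simp [indicator]
    have e2 : Iio y ∩ Ioc a b = Ioo a y := by
      ext x; simp only [mem_inter_iff, mem_Iio, mem_Ioc, mem_Ioo] at hy ⊢; grind
    simp only [e]
    rw [integral_indicator measurableSet_Iio, hμ, Measure.restrict_restrict measurableSet_Iio, e2,
      ← integral_Ioc_eq_integral_Ioo,
      ContinuousLinearMap.integral_comp_comm _ (hf.mono_set (Ioc_subset_Ioc_right hy.2))]
    rfl

omit [CompleteSpace E] [CompleteSpace F] [CompleteSpace G] in
theorem continuous_of_primitive {f : ℝ → E} (hf : LocallyIntegrable f) {u : ℝ → E}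
    (hu : ∀ x y, u y - u x = ∫ t in x..y, f t) : Continuous u := by
  have e : u = fun y => u 0 + ∫ t in (0 : ℝ)..y, f t := by
    ext y; rw [← hu]; abel
  rw [e]
  exact continuous_const.add (intervalIntegral.continuous_primitive
    (fun _ _ => (hf.integrableOn_isCompact isCompact_uIcc).intervalIntegrable) 0)

/-- Integration by parts for primitives of locally integrable functions. -/
theorem intervalIntegral_bilin_primitive (B : E →L[ℝ] F →L[ℝ] G) {f u : ℝ → E} {g v : ℝ → F}
    (hf : LocallyIntegrable f) (hg : LocallyIntegrable g)
    (hu : ∀ x y, u y - u x = ∫ t in x..y, f t) (hv : ∀ x y, v y - v x = ∫ t in x..y, g t)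
    (a b : ℝ) :
    ∫ x in a..b, (B (f x) (v x) + B (u x) (g x)) = B (u b) (v b) - B (u a) (v a) := by
  wlog hab : a ≤ b generalizing a b
  · rw [intervalIntegral.integral_symm, this b a (le_of_not_ge hab)]
    abel
  have hcu := continuous_of_primitive hf hu
  have hcv := continuous_of_primitive hg hv
  have hf' : IntegrableOn f (Ioc a b) :=
    (hf.integrableOn_isCompact isCompact_Icc).mono_set Ioc_subset_Icc_self
  have hg' : IntegrableOn g (Ioc a b) :=
    (hg.integrableOn_isCompact isCompact_Icc).mono_set Ioc_subset_Icc_self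
  have i1 : ∀ w : ℝ → F, Continuous w → IntegrableOn (fun x => B (f x) (w x)) (Ioc a b) := by
    intro w hw
    obtain ⟨C, hC⟩ := isCompact_Icc.exists_bound_of_continuousOn (hw.continuousOn (s := Icc a b))
    refine B.integrable_of_bilin_of_bdd_right C hf' hw.aestronglyMeasurable ?_
    exact (ae_restrict_iff' measurableSet_Ioc).2
      (Filter.Eventually.of_forall fun x hx => hC x (Ioc_subset_Icc_self hx))
  have i2 : ∀ w : ℝ → E, Continuous w → IntegrableOn (fun x => B (w x) (g x)) (Ioc a b) := by
    intro w hw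
    obtain ⟨C, hC⟩ := isCompact_Icc.exists_bound_of_continuousOn (hw.continuousOn (s := Icc a b))
    refine B.integrable_of_bilin_of_bdd_left C hw.aestronglyMeasurable ?_ hg'
    exact (ae_restrict_iff' measurableSet_Ioc).2
      (Filter.Eventually.of_forall fun x hx => hC x (Ioc_subset_Icc_self hx))
  have eu : ∀ x ∈ Ioc a b, u x - u a = ∫ t in Ioc a x, f t := fun x hx => by
    rw [hu, intervalIntegral.integral_of_le hx.1.le]
  have ev : ∀ x ∈ Ioc a b, v x - v a = ∫ t in Ioc a x, g t := fun x hx => by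
    rw [hv, intervalIntegral.integral_of_le hx.1.le]
  -- The version for primitives vanishing at `a` is applied to `u - u a` and `v - v a`; `k1` and
  -- `k2` account for the subtracted constants.
  have key := setIntegral_bilin_primitive B hf' hg'
  have k1 : (∫ x in Ioc a b, B (f x) (∫ t in Ioc a x, g t)) =
      (∫ x in Ioc a b, B (f x) (v x)) - B (u b - u a) (v a) := by
    have e1 : (∫ x in Ioc a b, B (f x) (v a)) = B (u b - u a) (v a) := by
      rw [hu, intervalIntegral.integral_of_le hab]
      exact (B.flip (v a)).integral_comp_comm hf'
    rw [← e1, ← integral_sub (i1 v hcv) (i1 _ continuous_const)]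
    refine setIntegral_congr_fun measurableSet_Ioc fun x hx => ?_
    simp only [← ev x hx, map_sub]
  have k2 : (∫ x in Ioc a b, B (∫ t in Ioc a x, f t) (g x)) =
      (∫ x in Ioc a b, B (u x) (g x)) - B (u a) (v b - v a) := by
    have e1 : (∫ x in Ioc a b, B (u a) (g x)) = B (u a) (v b - v a) := by
      rw [hv, intervalIntegral.integral_of_le hab]
      exact (B (u a)).integral_comp_comm hg'
    rw [← e1, ← integral_sub (i2 u hcu) (i2 _ continuous_const)]
    refine setIntegral_congr_fun measurableSet_Ioc fun x hx => ?_
    simp only [← eu x hx, map_sub, sub_apply]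
  rw [k1, k2, ← intervalIntegral.integral_of_le (f := f) hab, ← hu,
    ← intervalIntegral.integral_of_le (f := g) hab, ← hv] at key
  rw [intervalIntegral.integral_of_le hab, integral_add (i1 v hcv) (i2 u hcu)]
  simp only [map_sub, sub_apply] at key
  rw [← sub_eq_zero] at key ⊢
  rw [← key]
  abel

end Primitive

/-- A compact subset of an open order-connected set of reals lies in a compact interval contained
in that set. -/
theorem exists_Icc_of_isCompact {s K : Set ℝ} (hs : s.OrdConnected) (hK : IsCompact K)
    (hKs : K ⊆ s) (hne : s.Nonempty) : ∃ a b, a ≤ b ∧ K ⊆ Icc a b ∧ Icc a b ⊆ s := by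
  rcases K.eq_empty_or_nonempty with rfl | h
  · obtain ⟨a, ha⟩ := hne
    exact ⟨a, a, le_rfl, empty_subset _, by simpa using ha⟩
  · obtain ⟨a, ha, ha'⟩ := hK.exists_isLeast h
    obtain ⟨b, hb, hb'⟩ := hK.exists_isGreatest h
    exact ⟨a, b, ha' hb, fun x hx => ⟨ha' hx, hb' hx⟩, hs.out (hKs ha) (hKs hb)⟩

/-- There is a smooth function with compact support in a given nonempty open set and with
integral `1`. -/
theorem exists_test_integral_eq_one {s : Set ℝ} (hs : IsOpen s) (hne : s.Nonempty) :
    ∃ ρ : ℝ → ℝ, ContDiff ℝ ∞ ρ ∧ HasCompactSupport ρ ∧ tsupport ρ ⊆ s ∧ ∫ x, ρ x = 1 := by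
  obtain ⟨c, hc⟩ := hne
  obtain ⟨ε, hε, h⟩ := Metric.isOpen_iff.1 hs c hc
  let f : ContDiffBump c := ⟨ε / 4, ε / 2, by positivity, by linarith⟩
  refine ⟨f.normed volume, f.contDiff_normed, f.hasCompactSupport_normed, ?_, f.integral_normed⟩
  rw [f.tsupport_normed_eq]
  exact (Metric.closedBall_subset_ball (by change ε / 2 < ε; linarith)).trans h

/-- A smooth function with integral `0` and compact support in an open interval is the derivative
of such a function. -/
theorem exists_test_primitive {s : Set ℝ} (hs : s.OrdConnected) (hne : s.Nonempty)
    {η : ℝ → ℝ} (h1 : ContDiff ℝ ∞ η) (h2 : HasCompactSupport η) (h3 : tsupport η ⊆ s)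
    (h4 : ∫ x, η x = 0) :
    ∃ ζ : ℝ → ℝ, ContDiff ℝ ∞ ζ ∧ HasCompactSupport ζ ∧ tsupport ζ ⊆ s ∧ deriv ζ = η := by
  obtain ⟨a, b, hab, hK, hs'⟩ := exists_Icc_of_isCompact hs h2 h3 hne
  have hd : ∀ x, HasDerivAt (fun x => ∫ t in a..x, η t) (η x) x := fun x =>
    intervalIntegral.integral_hasDerivAt_right (h1.continuous.intervalIntegrable _ _)
      h1.continuous.aestronglyMeasurable.stronglyMeasurableAtFilter h1.continuous.continuousAt
  have hde : deriv (fun x => ∫ t in a..x, η t) = η := funext fun x => (hd x).deriv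
  have hη : ∀ x, x ∉ Icc a b → η x = 0 := fun x hx =>
    image_eq_zero_of_notMem_tsupport fun h => hx (hK h)
  have hz : ∀ x, x ∉ Icc a b → ∫ t in a..x, η t = 0 := by
    intro x hx
    rcases lt_or_ge x a with h | h
    · refine (intervalIntegral.integral_congr_ae ?_).trans intervalIntegral.integral_zero
      have : ∀ᵐ t : ℝ, t ≠ a := by simp [ae_iff, measure_singleton]
      filter_upwards [this] with t ht hta
      rw [uIoc_of_ge h.le] at hta
      exact hη t fun h' => ht (le_antisymm hta.2 h'.1)
    · have hb : b < x := by
        by_contra! hb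
        exact hx ⟨h, hb⟩
      rw [intervalIntegral.integral_eq_integral_of_support_subset, h4]
      have hηs : Function.support η ⊆ Icc a b := (subset_tsupport η).trans hK
      -- The interval integral runs over `Ioc a x`, so the support must also avoid the left
      -- end-point; continuity from the left ensures this.
      have hηa : η a = 0 := by
        have hc : Filter.Tendsto η (nhdsWithin a (Iio a)) (nhds (η a)) :=
          (h1.continuous.tendsto a).mono_left nhdsWithin_le_nhds
        refine tendsto_nhds_unique hc (tendsto_const_nhds.congr' ?_)
        filter_upwards [self_mem_nhdsWithin] with y hy
        exact (hη y fun h' => absurd h'.1 (not_le.2 hy)).symm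
      intro t ht
      have := hηs ht
      refine ⟨lt_of_le_of_ne this.1 ?_, this.2.trans hb.le⟩
      rintro rfl
      exact ht hηa
  have hsupp : Function.support (fun x => ∫ t in a..x, η t) ⊆ Icc a b := fun x hx => by
    by_contra h
    exact hx (hz x h)
  have hts : tsupport (fun x => ∫ t in a..x, η t) ⊆ Icc a b :=
    closure_minimal hsupp isClosed_Icc
  refine ⟨fun x => ∫ t in a..x, η t, ?_, ?_, hts.trans hs', hde⟩
  · rw [contDiff_infty_iff_deriv, hde]
    exact ⟨fun x => (hd x).differentiableAt, h1⟩
  · exact HasCompactSupport.of_support_subset_isCompact isCompact_Icc hsupp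

end HalfLine

/-! ### Weak derivatives, boundary values and Green's formula on half-lines -/

namespace HalfLine

variable {E : Type*} [NormedAddCommGroup E] [InnerProductSpace ℂ E]

/-- The real part of the inner product as a bounded real bilinear map. -/
noncomputable def reInner (E : Type*) [NormedAddCommGroup E] [InnerProductSpace ℂ E] :
    E →L[ℝ] E →L[ℝ] ℝ :=
  LinearMap.mkContinuous₂
    (LinearMap.mk₂ ℝ (fun x y => (inner ℂ x y).re)
      (fun x y z => by rw [inner_add_left, Complex.add_re])
      (fun c x y => by
        rw [← Complex.coe_smul, inner_smul_left, Complex.conj_ofReal, Complex.re_ofReal_mul]; rfl)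
      (fun x y z => by rw [inner_add_right, Complex.add_re])
      (fun c x y => by
        rw [← Complex.coe_smul, inner_smul_right, Complex.re_ofReal_mul]; rfl)) 1
    (fun x y => by
      rw [one_mul]
      exact (Complex.abs_re_le_norm _).trans (norm_inner_le_norm x y))

theorem reInner_apply (x y : E) : reInner E x y = (inner ℂ x y).re := rfl

theorem reInner_self (x : E) : reInner E x x = ‖x‖ ^ 2 := by
  rw [reInner_apply, inner_self_eq_norm_sq_to_K]
  norm_cast

section Weak

variable [CompleteSpace E]

/-- A primitive `u` of `f` has `f` as its weak derivative. -/
theorem integral_deriv_smul_primitive {f u : ℝ → E} (hf : LocallyIntegrable f)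
    (hu : ∀ x y, u y - u x = ∫ t in x..y, f t) {η : ℝ → ℝ} (h1 : ContDiff ℝ ∞ η)
    (h2 : HasCompactSupport η) : ∫ x, deriv η x • u x = -∫ x, η x • f x := by
  have hd : Continuous (deriv η) := h1.continuous_deriv (by simp)
  have hcu := continuous_of_primitive hf hu
  have i1 : Integrable (fun x => deriv η x • u x) :=
    hcu.locallyIntegrable.integrable_smul_left_of_hasCompactSupport hd h2.deriv
  have i2 : Integrable (fun x => η x • f x) :=
    hf.integrable_smul_left_of_hasCompactSupport h1.continuous h2
  -- On an interval containing the support of `η` in its interior, the boundary terms of the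
  -- integration by parts vanish.
  obtain ⟨R, hR⟩ := h2.isBounded.subset_ball 0
  have hR' : tsupport η ⊆ Ioo (-R) R := by
    rwa [Real.ball_eq_Ioo, zero_sub, zero_add] at hR
  have hη : ∀ x, x ∉ Ioo (-R) R → η x = 0 := fun x hx =>
    image_eq_zero_of_notMem_tsupport fun h => hx (hR' h)
  have hdη : ∀ x, x ∉ Ioo (-R) R → deriv η x = 0 := fun x hx =>
    Function.notMem_support.1 fun h => hx (hR' (support_deriv_subset h))
  have hη' : ∀ x y, η y - η x = ∫ t in x..y, deriv η t := fun x y =>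
    (intervalIntegral.integral_eq_sub_of_hasDerivAt
      (fun t _ => (h1.differentiable (by simp) t).hasDerivAt)
      (hd.intervalIntegrable _ _)).symm
  have key := intervalIntegral_bilin_primitive (ContinuousLinearMap.lsmul ℝ ℝ (E := E))
    hd.locallyIntegrable hf hη' hu (-R) R
  simp only [ContinuousLinearMap.lsmul_apply] at key
  rw [hη R (by simp), hη (-R) (by simp), zero_smul, zero_smul, sub_zero,
    intervalIntegral.integral_eq_integral_of_support_subset, integral_add i1 i2] at key
  · exact eq_neg_of_add_eq_zero_left key
  · intro x hx
    by_contra h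
    have h' : x ∉ Ioo (-R) R := fun h' => h (Ioo_subset_Ioc_self h')
    exact hx (by simp [hη x h', hdη x h'])

/-- A locally integrable function whose weak derivative on an open interval vanishes is constant
there. -/
theorem ae_eq_const_of_integral_deriv_smul_eq_zero {s : Set ℝ} (hs : IsOpen s)
    (ho : s.OrdConnected) (hne : s.Nonempty) {u : ℝ → E} (hu : LocallyIntegrable u)
    (h : ∀ η : ℝ → ℝ, ContDiff ℝ ∞ η → HasCompactSupport η → tsupport η ⊆ s →
      ∫ x, deriv η x • u x = 0) : ∃ c, ∀ᵐ x, x ∈ s → u x = c := by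
  obtain ⟨ρ, r1, r2, r3, r4⟩ := exists_test_integral_eq_one hs hne
  -- If `u` is constant on `s`, its average against `ρ` is that constant.
  refine ⟨∫ x, ρ x • u x, ?_⟩
  set c := ∫ x, ρ x • u x with hc
  have key := hs.ae_eq_zero_of_integral_contDiff_smul_eq_zero (μ := volume)
    (f := fun x => u x - c)
    ((hu.sub continuous_const.locallyIntegrable).locallyIntegrableOn s) fun η h1 h2 h3 => ?_
  · filter_upwards [key] with x hx hxs
    exact sub_eq_zero.1 (hx hxs)
  · have iη : Integrable η := h1.continuous.integrable_of_hasCompactSupport h2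
    have iρ : Integrable ρ := r1.continuous.integrable_of_hasCompactSupport r2
    have iηu : Integrable (fun x => η x • u x) :=
      hu.integrable_smul_left_of_hasCompactSupport h1.continuous h2
    have iρu : Integrable (fun x => ρ x • u x) :=
      hu.integrable_smul_left_of_hasCompactSupport r1.continuous r2
    set k := ∫ x, η x with hk
    -- The du Bois-Reymond argument: `η - (∫ η) ρ` has integral zero, hence is the derivative of a
    -- test function, so the hypothesis says exactly that `η` annihilates `u - c`.
    obtain ⟨ζ, z1, z2, z3, z4⟩ := exists_test_primitive ho hne (η := fun x => η x - k * ρ x)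
      (h1.sub (contDiff_const.mul r1)) (h2.sub (r2.mul_left (f := fun _ => k)))
      ((tsupport_sub _ _).trans (union_subset h3 ((closure_mono fun x hx => by
        exact right_ne_zero_of_mul hx).trans r3)))
      (by rw [integral_sub iη (iρ.const_mul k), integral_const_mul, r4, mul_one, sub_self])
    have h0 := h ζ z1 z2 z3
    rw [z4] at h0
    simp only [sub_smul, mul_smul] at h0
    rw [integral_sub iηu (show Integrable (fun x => k • ρ x • u x) from iρu.smul k),
      integral_smul, ← hc] at h0
    simp only [smul_sub]
    rw [integral_sub iηu (iη.smul_const c), integral_smul_const, ← hk]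
    exact h0

omit [CompleteSpace E] in
-- Passes from an `L²(s)` class to a representative on the whole line, as a function supported in
-- `s` does not see the complement.
theorem setIntegral_smul_eq_integral {s : Set ℝ} {η : ℝ → ℝ} {u w : ℝ → E}
    (h : ∀ x ∉ s, η x = 0) (huw : ∀ᵐ x ∂volume.restrict s, u x = w x) :
    ∫ x in s, η x • u x = ∫ x, η x • w x := by
  rw [← setIntegral_eq_integral_of_forall_compl_eq_zero (s := s) (f := fun x => η x • w x)
    fun x hx => by rw [h x hx, zero_smul]]
  exact integral_congr_ae (huw.mono fun x hx => by simp only [hx])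

theorem test_eq_zero {s : Set ℝ} {η : ℝ → ℝ} (h3 : tsupport η ⊆ s) :
    ∀ x ∉ s, η x = 0 := fun _ hx => image_eq_zero_of_notMem_tsupport fun h => hx (h3 h)

theorem deriv_test_eq_zero {s : Set ℝ} {η : ℝ → ℝ} (h3 : tsupport η ⊆ s) :
    ∀ x ∉ s, deriv η x = 0 := fun _ hx =>
  Function.notMem_support.1 fun h => hx (h3 (support_deriv_subset h))

theorem IsWeakDeriv.of_primitive {s : Set ℝ} {v w : L2 E s} {f u : ℝ → E}
    (hf : LocallyIntegrable f) (hu : ∀ x y, u y - u x = ∫ t in x..y, f t)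
    (hv : v =ᵐ[volume.restrict s] u) (hw : w =ᵐ[volume.restrict s] f) : IsWeakDeriv v w := by
  intro η h1 h2 h3
  rw [setIntegral_smul_eq_integral (deriv_test_eq_zero h3) hv,
    setIntegral_smul_eq_integral (test_eq_zero h3) hw]
  exact integral_deriv_smul_primitive hf hu h1 h2

omit [InnerProductSpace ℂ E] [CompleteSpace E] in
theorem memLp_indicator_L2 {s : Set ℝ} (hs : MeasurableSet s) (w : L2 E s) :
    MemLp (s.indicator w) 2 volume := (memLp_indicator_iff_restrict hs).2 (Lp.memLp w)

omit [InnerProductSpace ℂ E] [CompleteSpace E] in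
theorem locallyIntegrable_indicator_L2 {s : Set ℝ} (hs : MeasurableSet s) (w : L2 E s) :
    LocallyIntegrable (s.indicator w) volume :=
  (memLp_indicator_L2 hs w).locallyIntegrable (by norm_num)

omit [InnerProductSpace ℂ E] [CompleteSpace E] in
theorem ae_eq_indicator {s : Set ℝ} (hs : MeasurableSet s) (w : L2 E s) :
    ∀ᵐ x ∂volume.restrict s, w x = s.indicator w x :=
  (ae_restrict_iff' hs).2 (Filter.Eventually.of_forall fun _ hx => (indicator_of_mem hx _).symm)

/-- A function in the Sobolev space of an open interval has a representative that is a primitive of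
its weak derivative. -/
theorem IsWeakDeriv.exists_primitive {s : Set ℝ} (hs : IsOpen s) (ho : s.OrdConnected)
    (hne : s.Nonempty) {v w : L2 E s} (h : IsWeakDeriv v w) :
    ∃ u : ℝ → E, (∀ x y, u y - u x = ∫ t in x..y, s.indicator w t) ∧
      v =ᵐ[volume.restrict s] u := by
  have hm := hs.measurableSet
  have hw := locallyIntegrable_indicator_L2 hm w
  have hint : ∀ x y, IntervalIntegrable (s.indicator w) volume x y := fun x y =>
    (hw.integrableOn_isCompact isCompact_uIcc).intervalIntegrable
  set u₀ : ℝ → E := fun x => ∫ t in (0 : ℝ)..x, s.indicator w t with hu₀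
  have hp : ∀ x y, u₀ y - u₀ x = ∫ t in x..y, s.indicator w t := fun x y =>
    intervalIntegral.integral_interval_sub_left (hint _ _) (hint _ _)
  have hc := continuous_of_primitive hw hp
  -- The function `v` and the primitive `u₀` of `w` have the same weak derivative on `s`, so they
  -- differ there by a constant. Extending by zero lets the primitive live on the whole line.
  obtain ⟨c, hc'⟩ := ae_eq_const_of_integral_deriv_smul_eq_zero hs ho hne
    (u := fun x => s.indicator v x - u₀ x)
    ((locallyIntegrable_indicator_L2 hm v).sub hc.locallyIntegrable) fun η h1 h2 h3 => by
      have hd : Continuous (deriv η) := h1.continuous_deriv (by simp)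
      simp only [smul_sub]
      rw [integral_sub
        ((locallyIntegrable_indicator_L2 hm v).integrable_smul_left_of_hasCompactSupport hd h2.deriv)
        (hc.locallyIntegrable.integrable_smul_left_of_hasCompactSupport hd h2.deriv),
        integral_deriv_smul_primitive hw hp h1 h2,
        ← setIntegral_smul_eq_integral (deriv_test_eq_zero h3) (ae_eq_indicator hm v),
        ← setIntegral_smul_eq_integral (test_eq_zero h3) (ae_eq_indicator hm w),
        h η h1 h2 h3, sub_self]
  refine ⟨fun x => u₀ x + c, fun x y => (add_sub_add_right_eq_sub _ _ _).trans (hp x y), ?_⟩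
  refine (ae_restrict_iff' hm).2 (hc'.mono fun x hx hxs => ?_)
  rw [← hx hxs, indicator_of_mem hxs]
  exact (add_sub_cancel _ _).symm

/-- Integration by parts with `B = Re ⟨·, ·⟩`; the real part is taken because the inner product is
only sesquilinear. -/
theorem normSq_primitive_sub {f u : ℝ → E} (hf : LocallyIntegrable f)
    (hu : ∀ x y, u y - u x = ∫ t in x..y, f t) (a b : ℝ) :
    ∫ x in a..b, 2 * (inner ℂ (u x) (f x)).re = ‖u b‖ ^ 2 - ‖u a‖ ^ 2 := by
  have key := intervalIntegral_bilin_primitive (reInner E) hf hf hu hu a b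
  rw [reInner_self, reInner_self] at key
  rw [← key]
  refine intervalIntegral.integral_congr fun x _ => ?_
  simp only [reInner_apply]
  rw [← inner_conj_symm (f x), Complex.conj_re]
  ring

omit [CompleteSpace E] in
theorem integrableOn_re_inner {s : Set ℝ} (hs : MeasurableSet s) {v w : L2 E s} {u : ℝ → E}
    (h : v =ᵐ[volume.restrict s] u) :
    IntegrableOn (fun x => 2 * (inner ℂ (u x) (s.indicator w x)).re) s ∧
      ∫ x in s, 2 * (inner ℂ (u x) (s.indicator w x)).re = 2 * (inner ℂ v w).re := by
  have e : (fun x => 2 * (inner ℂ (u x) (s.indicator w x)).re) =ᵐ[volume.restrict s]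
      fun x => 2 * (inner ℂ (v x) (w x)).re := by
    filter_upwards [h, ae_eq_indicator hs w] with x h1 h2
    rw [h1, ← h2]
  have hi := L2.integrable_inner (𝕜 := ℂ) v w
  refine ⟨(hi.re.const_mul 2).congr e.symm, ?_⟩
  rw [integral_congr_ae e, integral_const_mul, L2.inner_def]
  congr 1
  exact integral_re hi

omit [InnerProductSpace ℂ E] [CompleteSpace E] in
theorem integrableOn_norm_sq {s : Set ℝ} {v : L2 E s} {u : ℝ → E}
    (h : v =ᵐ[volume.restrict s] u) : IntegrableOn (fun x => ‖u x‖ ^ 2) s :=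
  ((Lp.memLp v).integrable_norm_pow (p := 2) two_ne_zero).congr
    (h.mono fun x hx => by simp only [hx])

/-- The formula `2 Re ⟨v, v'⟩ = -‖v(0)‖²` in the Sobolev space of the positive half-line. -/
theorem green_Ioi {v w : L2 E (Ioi 0)} (h : IsWeakDeriv v w) :
    ∃ e, HasBoundaryValue v e ∧ 2 * (inner ℂ v w).re = -1 * ‖e‖ ^ 2 := by
  obtain ⟨u, hu, hvu⟩ := h.exists_primitive isOpen_Ioi ordConnected_Ioi nonempty_Ioi
  have hw := locallyIntegrable_indicator_L2 measurableSet_Ioi w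
  refine ⟨u 0, ⟨u, (continuous_of_primitive hw hu).continuousOn, hvu, rfl⟩, ?_⟩
  obtain ⟨i1, i2⟩ := integrableOn_re_inner measurableSet_Ioi (w := w) hvu
  have lim := intervalIntegral_tendsto_integral_Ioi 0 i1 Filter.tendsto_id
  simp only [normSq_primitive_sub hw hu, i2, id] at lim
  have lim' : Filter.Tendsto (fun x => ‖u x‖ ^ 2) Filter.atTop
      (nhds (2 * (inner ℂ v w).re + ‖u 0‖ ^ 2)) :=
    (lim.add_const (‖u 0‖ ^ 2)).congr fun _ => sub_add_cancel _ _
  -- The function `‖u‖²` converges at infinity and is integrable there; since neighbourhoods of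
  -- infinity have infinite measure, the limit is zero.
  have h0 := IntegrableAtFilter.eq_zero_of_tendsto
    ⟨Ioi 0, Filter.Ioi_mem_atTop 0, integrableOn_norm_sq hvu⟩ (fun s hs => by
      obtain ⟨b, hb⟩ := Filter.mem_atTop_sets.1 hs
      exact top_le_iff.1 (Real.volume_Ici (a := b) ▸ measure_mono hb)) lim'
  linarith

/-- The formula `2 Re ⟨v, v'⟩ = ‖v(0)‖²` in the Sobolev space of the negative half-line. -/
theorem green_Iio {v w : L2 E (Iio 0)} (h : IsWeakDeriv v w) :
    ∃ e, HasBoundaryValue v e ∧ 2 * (inner ℂ v w).re = 1 * ‖e‖ ^ 2 := by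
  obtain ⟨u, hu, hvu⟩ := h.exists_primitive isOpen_Iio ordConnected_Iio nonempty_Iio
  have hw := locallyIntegrable_indicator_L2 measurableSet_Iio w
  refine ⟨u 0, ⟨u, (continuous_of_primitive hw hu).continuousOn, hvu, rfl⟩, ?_⟩
  obtain ⟨i1, i2⟩ := integrableOn_re_inner measurableSet_Iio (w := w) hvu
  rw [← integral_Iic_eq_integral_Iio] at i2
  rw [← integrableOn_Iic_iff_integrableOn_Iio] at i1
  have lim := intervalIntegral_tendsto_integral_Iic 0 i1 Filter.tendsto_id
  simp only [normSq_primitive_sub hw hu, i2, id] at lim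
  have lim' : Filter.Tendsto (fun x => ‖u x‖ ^ 2) Filter.atBot
      (nhds (‖u 0‖ ^ 2 - 2 * (inner ℂ v w).re)) :=
    (lim.const_sub (‖u 0‖ ^ 2)).congr fun _ => sub_sub_cancel _ _
  have h0 := IntegrableAtFilter.eq_zero_of_tendsto
    ⟨Iio 0, Filter.Iio_mem_atBot 0, integrableOn_norm_sq hvu⟩ (fun s hs => by
      obtain ⟨b, hb⟩ := Filter.mem_atBot_sets.1 hs
      exact top_le_iff.1 (Real.volume_Iic (a := b) ▸ measure_mono hb)) lim'
  linarith

end Weak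

omit [InnerProductSpace ℂ E] in
-- Two continuous representatives that agree almost everywhere agree on the open set `s`, and by
-- continuity on its closure, which contains `0`.
theorem HasBoundaryValue.unique {s : Set ℝ} (hs : IsOpen s) (h0 : (0 : ℝ) ∈ closure s)
    {v : L2 E s} {e e' : E} (h : HasBoundaryValue v e) (h' : HasBoundaryValue v e') : e = e' := by
  obtain ⟨g, h1, h2, rfl⟩ := h
  obtain ⟨g', h1', h2', rfl⟩ := h'
  have key : EqOn g g' s := Measure.eqOn_open_of_ae_eq (h2.symm.trans h2') hs
    (h1.mono subset_closure) (h1'.mono subset_closure)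
  exact key.of_subset_closure h1 h1' subset_closure subset_rfl h0

omit [InnerProductSpace ℂ E] in
theorem boundaryValue_eq {s : Set ℝ} (hs : IsOpen s) (h0 : (0 : ℝ) ∈ closure s)
    {v : L2 E s} {e : E} (h : HasBoundaryValue v e) : boundaryValue v = e := by
  have hex : ∃ e, HasBoundaryValue v e := ⟨e, h⟩
  rw [boundaryValue, dif_pos hex]
  exact hex.choose_spec.unique hs h0 h

end HalfLine

/-! ### The operators `i y'` on a half-line and their resolvent sets -/

namespace HalfLine

variable {E : Type*} [NormedAddCommGroup E] [InnerProductSpace ℂ E]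

variable (E) in
/-- An open set `s` of reals with the end-point `0`, such that Green's formula holds in
`W¹₂(s, E)`; the sign `σ` is `1` for the negative and `-1` for the positive half-line. -/
structure IsHalfLine (s : Set ℝ) (σ : ℝ) : Prop where
  isOpen : IsOpen s
  zero_mem_closure : (0 : ℝ) ∈ closure s
  zero_notMem : (0 : ℝ) ∉ s
  sign_ne_zero : σ ≠ 0
  green : ∀ {v w : L2 E s}, IsWeakDeriv v w →
    ∃ e, HasBoundaryValue v e ∧ 2 * (inner ℂ v w).re = σ * ‖e‖ ^ 2
  integrableOn_exp : ∀ a : ℝ, 0 < σ * a → IntegrableOn (fun x => Real.exp (a * x)) s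

theorem isHalfLine_Ioi [CompleteSpace E] : IsHalfLine E (Ioi 0) (-1) where
  isOpen := isOpen_Ioi
  zero_mem_closure := by simp
  zero_notMem := by simp
  sign_ne_zero := by norm_num
  green := green_Ioi
  integrableOn_exp a ha := integrableOn_exp_mul_Ioi (by linarith) 0

theorem isHalfLine_Iio [CompleteSpace E] : IsHalfLine E (Iio 0) 1 where
  isOpen := isOpen_Iio
  zero_mem_closure := by simp
  zero_notMem := by simp
  sign_ne_zero := by norm_num
  green := green_Iio
  integrableOn_exp a ha := (integrableOn_exp_mul_Iic (by linarith) 0).mono_set Iio_subset_Iic_self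

/-- The function `x ↦ η(x) e` in `L²(s, E)`. -/
noncomputable def testLp (s : Set ℝ) {η : ℝ → ℝ} (h1 : Continuous η) (h2 : HasCompactSupport η)
    (e : E) : L2 E s :=
  MemLp.toLp (fun x => η x • e) (μ := volume.restrict s)
    ((h1.smul continuous_const).memLp_of_hasCompactSupport (h2.smul_right (f' := fun _ => e)))

theorem coeFn_testLp (s : Set ℝ) {η : ℝ → ℝ} (h1 : Continuous η)
    (h2 : HasCompactSupport η) (e : E) :
    testLp s h1 h2 e =ᵐ[volume.restrict s] fun x => η x • e :=
  MemLp.coeFn_toLp _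

theorem inner_testLp [CompleteSpace E] {s : Set ℝ} {η : ℝ → ℝ} (h1 : Continuous η)
    (h2 : HasCompactSupport η) (e : E) (v : L2 E s) :
    inner ℂ (testLp s h1 h2 e) v = inner ℂ e (∫ x in s, η x • v x) := by
  rw [L2.inner_def, ← integral_inner (integrable_smul_L2 v h1 h2)]
  refine integral_congr_ae ?_
  filter_upwards [coeFn_testLp s h1 h2 e] with x hx
  rw [hx, ← Complex.coe_smul, ← Complex.coe_smul, inner_smul_left, inner_smul_right,
    Complex.conj_ofReal]

/-- Pairing with every vector `e` turns the vector-valued identity into scalar conditions that are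
continuous in `(v, w)`. Closedness of the graph and the orthogonality arguments below rest on this
form. -/
theorem isWeakDeriv_iff_inner [CompleteSpace E] {s : Set ℝ} (v w : L2 E s) :
    IsWeakDeriv v w ↔ ∀ (η : ℝ → ℝ) (h1 : ContDiff ℝ ∞ η) (h2 : HasCompactSupport η),
      tsupport η ⊆ s → ∀ e : E,
      inner ℂ (testLp s (h1.continuous_deriv (by simp)) h2.deriv e) v =
        -inner ℂ (testLp s h1.continuous h2 e) w := by
  simp only [inner_testLp, ← inner_neg_right]
  constructor
  · intro h η h1 h2 h3 e
    rw [h η h1 h2 h3]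
  · intro h η h1 h2 h3
    exact ext_inner_left ℂ (h η h1 h2 h3)

theorem isClosed_weakDerivGraph [CompleteSpace E] (s : Set ℝ) :
    IsClosed (weakDerivGraph (E := E) s : Set (L2 E s × L2 E s)) := by
  have : (weakDerivGraph (E := E) s : Set (L2 E s × L2 E s)) =
      ⋂ (η : ℝ → ℝ) (h1 : ContDiff ℝ ∞ η) (h2 : HasCompactSupport η) (_ : tsupport η ⊆ s) (e : E),
      {p | inner ℂ (testLp s (h1.continuous_deriv (by simp)) h2.deriv e) p.1 =
        -inner ℂ (testLp s h1.continuous h2 e) p.2} := by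
    ext p
    simp only [mem_iInter, mem_ofPred_eq]
    exact isWeakDeriv_iff_inner p.1 p.2
  rw [this]
  refine isClosed_iInter fun η => isClosed_iInter fun h1 => isClosed_iInter fun h2 =>
    isClosed_iInter fun _ => isClosed_iInter fun e => isClosed_eq ?_ ?_
  · exact continuous_const.inner continuous_fst
  · exact (continuous_const.inner continuous_snd).neg

theorem testLp_mem_testGraph (s : Set ℝ) {η : ℝ → ℝ} (h1 : ContDiff ℝ ∞ η)
    (h2 : HasCompactSupport η) (h3 : tsupport η ⊆ s) (e : E) :
    (testLp s h1.continuous h2 e, testLp s (h1.continuous_deriv (by simp)) h2.deriv e) ∈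
      testGraph E s := by
  have hd : deriv (fun x => η x • e) = fun x => deriv η x • e := funext fun x =>
    deriv_smul_const (h1.differentiable (by simp) x) e
  refine ⟨fun x => η x • e, h1.smul contDiff_const, h2.smul_right (f' := fun _ => e),
    (closure_mono (Function.support_smul_subset_left η fun _ => e)).trans h3, coeFn_testLp s h1.continuous h2 e, ?_⟩
  rw [hd]
  exact coeFn_testLp s (h1.continuous_deriv (by simp)) h2.deriv e

theorem testGraph_le_weakDerivGraph [CompleteSpace E] (s : Set ℝ) :
    testGraph E s ≤ weakDerivGraph s := by
  rintro ⟨v, w⟩ ⟨η, h1, h2, h3, h4, h5⟩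
  have hd : Continuous (deriv η) := h1.continuous_deriv (by simp)
  exact IsWeakDeriv.of_primitive hd.locallyIntegrable (fun x y =>
    (intervalIntegral.integral_eq_sub_of_hasDerivAt
      (fun t _ => (h1.differentiable (by simp) t).hasDerivAt) (hd.intervalIntegrable _ _)).symm)
    h4 h5

theorem closure_testGraph_le [CompleteSpace E] (s : Set ℝ) :
    (testGraph E s).topologicalClosure ≤ weakDerivGraph s :=
  Submodule.topologicalClosure_minimal _ (testGraph_le_weakDerivGraph s)
    (isClosed_weakDerivGraph s)

theorem isWeakDeriv_sobolevDeriv [CompleteSpace E] {s : Set ℝ} (hs : IsOpen s) (v : W12 E s) :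
    IsWeakDeriv (v : L2 E s) (sobolevDeriv E s v) := by
  have h := (sobolevDeriv E s).mem_graph v
  rw [sobolevDeriv_graph hs] at h
  exact h

theorem IsWeakDeriv.sobolevDeriv_eq [CompleteSpace E] {s : Set ℝ} (hs : IsOpen s) {v w : L2 E s}
    (h : IsWeakDeriv v w) : ∃ hv : v ∈ W12 E s, sobolevDeriv E s ⟨v, hv⟩ = w := by
  have h' : (v, w) ∈ (sobolevDeriv E s).graph := by
    rw [sobolevDeriv_graph hs]
    exact h
  obtain ⟨⟨x, hx⟩, h1, h2⟩ := (LinearPMap.mem_graph_iff _).1 h'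
  obtain rfl : x = v := h1
  exact ⟨hx, h2⟩

/-- Solves `i v' - z v = y` for `v'`, so that resolvent equations become statements about weak
derivatives. -/
theorem neg_I_smul_eq_iff {V : Type*} [AddCommGroup V] [Module ℂ V] (z : ℂ) (v w y : V) :
    Complex.I • w - z • v = y ↔ w = -Complex.I • (y + z • v) := by
  rw [sub_eq_iff_eq_add]
  constructor
  · intro h
    rw [← h, smul_smul, neg_mul, Complex.I_mul_I, neg_neg, one_smul]
  · rintro rfl
    rw [smul_smul, mul_neg, Complex.I_mul_I, neg_neg, one_smul]

theorem mem_graph_momentum_sub [CompleteSpace E] {s : Set ℝ} (hs : IsOpen s) (z : ℂ)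
    (v y : L2 E s) : (v, y) ∈ (subScalar (momentum E s) z).graph ↔
      IsWeakDeriv v (-Complex.I • (y + z • v)) := by
  rw [LinearPMap.mem_graph_iff]
  constructor
  · rintro ⟨⟨x, hx⟩, h1, h2⟩
    obtain rfl : x = v := h1
    have h3 : Complex.I • sobolevDeriv E s ⟨x, hx⟩ - z • x = y := h2
    rw [neg_I_smul_eq_iff] at h3
    rw [← h3]
    exact isWeakDeriv_sobolevDeriv hs ⟨x, hx⟩
  · intro h
    obtain ⟨hv, h2⟩ := h.sobolevDeriv_eq hs
    exact ⟨⟨v, hv⟩, rfl, (neg_I_smul_eq_iff z v _ y).2 h2⟩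

theorem mem_graph_momentumZero_sub [CompleteSpace E] {s : Set ℝ} (hs : IsOpen s) (z : ℂ)
    (v y : L2 E s) : (v, y) ∈ (subScalar (momentumZero E s) z).graph ↔
      (v, -Complex.I • (y + z • v)) ∈ (testGraph E s).topologicalClosure := by
  rw [LinearPMap.mem_graph_iff]
  constructor
  · rintro ⟨⟨x, hx⟩, h1, h2⟩
    obtain rfl : x = v := h1
    have hx1 : x ∈ W12zero E s := hx.1
    have hx2 : x ∈ W12 E s := hx.2
    have h3 : Complex.I • sobolevDeriv E s ⟨x, hx2⟩ - z • x = y := h2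
    rw [neg_I_smul_eq_iff] at h3
    obtain ⟨⟨x', w⟩, ⟨hp1, hp2⟩, hp3⟩ := hx1
    obtain rfl : x' = x := hp3
    obtain ⟨⟨x'', hx''⟩, e1, e2⟩ := (LinearPMap.mem_graph_iff _).1 hp2
    obtain rfl : x'' = x' := e1
    rw [← h3, e2]
    exact hp1
  · intro h
    have hw : IsWeakDeriv v (-Complex.I • (y + z • v)) := closure_testGraph_le s h
    obtain ⟨hv, h2⟩ := hw.sobolevDeriv_eq hs
    have h0 : v ∈ W12zero E s := by
      refine ⟨_, ⟨h, ?_⟩, rfl⟩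
      rw [sobolevDeriv_graph hs]
      exact hw
    exact ⟨⟨v, h0, hv⟩, rfl, (neg_I_smul_eq_iff z v _ y).2 h2⟩

theorem inner_neg_I_smul_re {V : Type*} [NormedAddCommGroup V] [InnerProductSpace ℂ V]
    (x y : V) : (inner ℂ x (-Complex.I • y)).re = (inner ℂ x y).im := by
  rw [inner_smul_right]
  simp

variable {s : Set ℝ} {σ : ℝ}

theorem IsHalfLine.boundaryValue_eq (hs : IsHalfLine E s σ) {v : L2 E s} {e : E}
    (h : HasBoundaryValue v e) : boundaryValue v = e :=
  HalfLine.boundaryValue_eq hs.isOpen hs.zero_mem_closure h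

theorem IsHalfLine.hasBoundaryValue (hs : IsHalfLine E s σ) {v w : L2 E s}
    (h : IsWeakDeriv v w) : HasBoundaryValue v (boundaryValue v) := by
  obtain ⟨e, he, -⟩ := hs.green h
  rwa [hs.boundaryValue_eq he]

theorem IsHalfLine.two_mul_re_inner (hs : IsHalfLine E s σ) {v w : L2 E s}
    (h : IsWeakDeriv v w) {e : E} (he : HasBoundaryValue v e) :
    2 * (inner ℂ v w).re = σ * ‖e‖ ^ 2 := by
  obtain ⟨e', he', h'⟩ := hs.green h
  rwa [he.unique hs.isOpen hs.zero_mem_closure he']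

/-- Test functions vanish at `0`, so Green's formula has no boundary term for them; the resulting
condition survives closure in the graph norm. -/
theorem IsHalfLine.re_inner_eq_zero [CompleteSpace E] (hs : IsHalfLine E s σ) {v w : L2 E s}
    (h : (v, w) ∈ (testGraph E s).topologicalClosure) : (inner ℂ v w).re = 0 := by
  have hcl : IsClosed {p : L2 E s × L2 E s | (inner ℂ p.1 p.2).re = 0} :=
    isClosed_eq (Complex.continuous_re.comp (continuous_fst.inner continuous_snd))
      continuous_const
  have hsub : (testGraph E s : Set (L2 E s × L2 E s)) ⊆ {p | (inner ℂ p.1 p.2).re = 0} := by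
    intro p hp
    obtain ⟨η, h1, h2, h3, h4, h5⟩ := id hp
    have hb : HasBoundaryValue p.1 (0 : E) :=
      ⟨η, h1.continuous.continuousOn, h4, image_eq_zero_of_notMem_tsupport fun h0 =>
        hs.zero_notMem (h3 h0)⟩
    have := hs.two_mul_re_inner (testGraph_le_weakDerivGraph s hp) hb
    rw [norm_zero] at this
    change (inner ℂ p.1 p.2).re = 0
    linarith
  exact closure_minimal hsub hcl h

/-- Functions in the closure of the test functions vanish at the end-point. -/
theorem IsHalfLine.hasBoundaryValue_zero [CompleteSpace E] (hs : IsHalfLine E s σ) {v w : L2 E s}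
    (h : (v, w) ∈ (testGraph E s).topologicalClosure) : HasBoundaryValue v 0 := by
  have hw : IsWeakDeriv v w := closure_testGraph_le s h
  have hb := hs.hasBoundaryValue hw
  have h1 := hs.two_mul_re_inner hw hb
  rw [hs.re_inner_eq_zero h, mul_zero, eq_comm, mul_eq_zero] at h1
  have h2 := h1.resolve_left hs.sign_ne_zero
  rw [sq_eq_zero_iff, norm_eq_zero] at h2
  rwa [h2] at hb

/-- A function that is orthogonal to `i η' - z η` for all test functions `η` is a weak solution of
the adjoint equation. -/
theorem isWeakDeriv_of_orthogonal [CompleteSpace E] {z : ℂ} {g : L2 E s}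
    (h : ∀ v w : L2 E s, (v, w) ∈ testGraph E s → inner ℂ g (Complex.I • w - z • v) = 0) :
    IsWeakDeriv g (-Complex.I • (conj z • g)) := by
  rw [isWeakDeriv_iff_inner]
  intro η h1 h2 h3 e
  have key := h _ _ (testLp_mem_testGraph s h1 h2 h3 e)
  rw [inner_sub_right, inner_smul_right, inner_smul_right] at key
  have key' := congrArg (starRingEnd ℂ) key
  rw [map_sub, map_mul, map_mul, inner_conj_symm, inner_conj_symm, map_zero, Complex.conj_I]
    at key'
  rw [inner_smul_right, inner_smul_right]
  linear_combination Complex.I * key' + inner ℂ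
    (testLp s (h1.continuous_deriv (by simp)) h2.deriv e) g * Complex.I_mul_I

/-- By Green's formula `Im ⟨v, i v'⟩ = σ ‖v(0)‖² / 2`. When `σ Im z < 0` this has the same sign as
`-Im z ‖v‖²`, so the boundary term only strengthens the lower bound. -/
theorem IsHalfLine.mem_resolventSetOp_momentum [CompleteSpace E] (hs : IsHalfLine E s σ) {z : ℂ}
    (hz : σ * z.im < 0) : z ∈ resolventSetOp (momentum E s) := by
  have hz0 : z.im ≠ 0 := right_ne_zero_of_mul hz.ne
  have hb : ∀ x : (subScalar (momentum E s) z).domain,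
      |z.im| * ‖(x : L2 E s)‖ ≤ ‖subScalar (momentum E s) z x‖ := by
    intro x
    refine bound_of_abs_im ?_
    have hw := isWeakDeriv_sobolevDeriv (E := E) hs.isOpen ⟨x, x.2⟩
    have h1 := hs.two_mul_re_inner hw (hs.hasBoundaryValue hw)
    have h2 := inner_sub_smul_im (x : L2 E s)
      (Complex.I • sobolevDeriv E s ⟨x, x.2⟩ : L2 E s) z
    have h3 : subScalar (momentum E s) z x =
      Complex.I • sobolevDeriv E s ⟨x, x.2⟩ - z • (x : L2 E s) := rfl
    rw [inner_smul_right, Complex.I_mul_im] at h2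
    rw [h3, h2]
    set q := (inner ℂ (x : L2 E s) (sobolevDeriv E s ⟨x, x.2⟩)).re with hq
    set k := ‖boundaryValue (x : L2 E s)‖ ^ 2 with hk
    have hk0 : 0 ≤ k := sq_nonneg _
    have hn : 0 ≤ ‖(x : L2 E s)‖ ^ 2 := sq_nonneg _
    change 2 * q = σ * k at h1
    rcases lt_or_gt_of_ne hz0 with h | h
    · have hσ : 0 < σ := pos_of_mul_neg_left hz h.le
      rw [abs_of_neg h, abs_of_nonneg] <;> nlinarith [mul_nonneg hσ.le hk0]
    · have hσ : σ < 0 := neg_of_mul_neg_left hz h.le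
      rw [abs_of_pos h, abs_of_nonpos] <;>
        nlinarith [mul_nonneg (neg_nonneg.2 hσ.le) hk0, mul_nonneg h.le hn]
  refine HasBoundedInverse.of_surjective (abs_pos.2 hz0) hb
    (surjective_of_isClosed (abs_pos.2 hz0) hb ?_ ?_)
  · change IsClosed ((subScalar (momentum E s) z).graph : Set (L2 E s × L2 E s))
    have e : ((subScalar (momentum E s) z).graph : Set (L2 E s × L2 E s)) =
        (fun p : L2 E s × L2 E s => (p.1, -Complex.I • (p.2 + z • p.1))) ⁻¹'
          (weakDerivGraph s : Submodule ℂ (L2 E s × L2 E s)) := by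
      ext p
      exact mem_graph_momentum_sub hs.isOpen z p.1 p.2
    rw [e]
    exact (isClosed_weakDerivGraph s).preimage (by fun_prop)
  · intro g hg
    have hg' : ∀ v w : L2 E s, IsWeakDeriv v w → inner ℂ g (Complex.I • w - z • v) = 0 := by
      intro v w h
      obtain ⟨hv, e⟩ := h.sobolevDeriv_eq hs.isOpen
      have := hg ⟨v, hv⟩
      rw [← e]
      exact this
    have hw := isWeakDeriv_of_orthogonal (z := z) fun v w h =>
      hg' v w (testGraph_le_weakDerivGraph s h)
    -- The orthogonal vector solves `i g' = conj z g` and thus lies in the domain; testing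
    -- orthogonality against `g` itself gives `(conj z - z) ‖g‖² = 0`.
    have h := hg' g _ hw
    rw [smul_smul, mul_neg, Complex.I_mul_I, neg_neg, one_smul, ← sub_smul, inner_smul_right,
      mul_eq_zero] at h
    refine inner_self_eq_zero.1 (h.resolve_left fun h0 => hz0 ?_)
    have := congrArg Complex.im h0
    simp at this
    linarith

/-- Here there is no boundary term, and the lower bound holds for every non-real `z`. The sign
condition matters for surjectivity: it excludes square-integrable solutions of `i g' = conj z g`. -/
theorem IsHalfLine.mem_resolventSetOp_momentumZero [CompleteSpace E] (hs : IsHalfLine E s σ)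
    {z : ℂ} (hz : 0 < σ * z.im) : z ∈ resolventSetOp (momentumZero E s) := by
  have hz0 : z.im ≠ 0 := right_ne_zero_of_mul hz.ne'
  have hb : ∀ x : (subScalar (momentumZero E s) z).domain,
      |z.im| * ‖(x : L2 E s)‖ ≤ ‖subScalar (momentumZero E s) z x‖ := by
    intro x
    refine bound_of_abs_im ?_
    have h1 := (mem_graph_momentumZero_sub hs.isOpen z _ _).1
      ((subScalar (momentumZero E s) z).mem_graph x)
    have h2 := hs.re_inner_eq_zero h1
    rw [inner_neg_I_smul_re] at h2
    have h3 := inner_sub_smul_im (x : L2 E s)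
      (subScalar (momentumZero E s) z x + z • (x : L2 E s)) z
    rw [add_sub_cancel_right, h2, zero_sub] at h3
    rw [h3, abs_neg, abs_mul, abs_of_nonneg (sq_nonneg ‖(x : L2 E s)‖)]
  refine HasBoundedInverse.of_surjective (abs_pos.2 hz0) hb
    (surjective_of_isClosed (abs_pos.2 hz0) hb ?_ ?_)
  · change IsClosed ((subScalar (momentumZero E s) z).graph : Set (L2 E s × L2 E s))
    have e : ((subScalar (momentumZero E s) z).graph : Set (L2 E s × L2 E s)) =
        (fun p : L2 E s × L2 E s => (p.1, -Complex.I • (p.2 + z • p.1))) ⁻¹'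
          (testGraph E s).topologicalClosure := by
      ext p
      exact mem_graph_momentumZero_sub hs.isOpen z p.1 p.2
    rw [e]
    exact (testGraph E s).isClosed_topologicalClosure.preimage (by fun_prop)
  · intro g hg
    have hw := isWeakDeriv_of_orthogonal (z := z) (g := g) fun v w h => by
      have h1 : (v, Complex.I • w - z • v) ∈ (subScalar (momentumZero E s) z).graph := by
        rw [mem_graph_momentumZero_sub hs.isOpen, ← (neg_I_smul_eq_iff z v w _).1 rfl]
        exact (testGraph E s).le_topologicalClosure h
      obtain ⟨x, -, h2⟩ := (LinearPMap.mem_graph_iff _).1 h1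
      have h3 := hg x
      rwa [h2] at h3
    have h1 := hs.two_mul_re_inner hw (hs.hasBoundaryValue hw)
    rw [inner_neg_I_smul_re] at h1
    have h2 := inner_sub_smul_im g 0 (-conj z)
    rw [neg_smul, sub_neg_eq_add, zero_add, inner_zero_right, Complex.zero_im, zero_sub,
      Complex.neg_im, Complex.conj_im, neg_neg] at h2
    rw [h2] at h1
    -- Green's formula for `g` reads `σ ‖g(0)‖² = -2 Im z ‖g‖²`; multiplying by `σ` gives both sides
    -- a definite sign, so `g = 0`.
    have h3 : σ ^ 2 * ‖boundaryValue g‖ ^ 2 = -(2 * (σ * z.im * ‖g‖ ^ 2)) := by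
      linear_combination -σ * h1
    have h4 : ‖g‖ ^ 2 ≤ 0 := by
      by_contra! h5
      nlinarith [mul_pos hz h5, mul_nonneg (sq_nonneg σ) (sq_nonneg ‖boundaryValue g‖)]
    exact norm_eq_zero.1 (by nlinarith [norm_nonneg g])

/-- The exponential solutions `e^{-izx} e` of `i v' = z v` that belong to `L²(s, E)`. -/
theorem IsHalfLine.exists_exp [CompleteSpace E] (hs : IsHalfLine E s σ) {z : ℂ}
    (hz : 0 < σ * z.im) (e : E) : ∃ v : L2 E s,
      (∀ᵐ x ∂volume.restrict s, v x = Complex.exp (-Complex.I * z * x) • e) ∧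
      IsWeakDeriv v (-Complex.I • (z • v)) ∧ HasBoundaryValue v e := by
  have hc : Continuous fun x : ℝ => Complex.exp (-Complex.I * z * x) • e := by fun_prop
  have hm : MemLp (fun x : ℝ => Complex.exp (-Complex.I * z * x) • e) 2 (volume.restrict s) := by
    rw [memLp_two_iff_integrable_sq_norm hc.aestronglyMeasurable]
    -- The squared modulus of `e^{-izx}` is `e^{2 (Im z) x}`.
    have h := (hs.integrableOn_exp (2 * z.im) (by linarith)).mul_const (‖e‖ ^ 2)
    refine h.congr (Filter.Eventually.of_forall fun x => ?_)
    beta_reduce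
    rw [norm_smul, Complex.norm_exp, mul_pow, ← Real.exp_nat_mul]
    congr 2
    simp
    ring
  have hv := hm.coeFn_toLp
  have hd : ∀ x : ℝ, HasDerivAt (fun x : ℝ => Complex.exp (-Complex.I * z * x) • e)
      ((-Complex.I * z) • Complex.exp (-Complex.I * z * x) • e) x := by
    intro x
    have h1 : HasDerivAt (fun y : ℂ => Complex.exp (-Complex.I * z * y))
        (Complex.exp (-Complex.I * z * x) * (-Complex.I * z * 1)) (x : ℂ) :=
      ((hasDerivAt_id (x : ℂ)).const_mul (-Complex.I * z)).cexp
    refine (h1.comp_ofReal.smul_const e).congr_deriv ?_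
    rw [mul_one, smul_smul, mul_comm]
  have hcd : Continuous fun x : ℝ => (-Complex.I * z) • Complex.exp (-Complex.I * z * x) • e := by
    fun_prop
  refine ⟨hm.toLp, hv, ?_, ⟨_, hc.continuousOn, hv, by simp⟩⟩
  refine IsWeakDeriv.of_primitive hcd.locallyIntegrable (fun x y =>
    (intervalIntegral.integral_eq_sub_of_hasDerivAt (fun t _ => hd t)
      (hcd.intervalIntegrable _ _)).symm) hv ?_
  rw [smul_smul]
  refine (Lp.coeFn_smul _ _).trans (hv.mono fun x hx => ?_)
  rw [Pi.smul_apply, hx]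

end HalfLine

/-! ### Green's formula in `H`, the `M`-function and the Krein formula -/

namespace RyzhovTriple

open HalfLine

variable {H E : Type*} [NormedAddCommGroup H] [InnerProductSpace ℂ H] [CompleteSpace H]
  [NormedAddCommGroup E] [InnerProductSpace ℂ E] [CompleteSpace E] (T : RyzhovTriple H E)

/-- The element `u` of `dom Γ₁` has `A u = f`, `Γ₀ u = e` and `Γ₁ u = g`. -/
def BoundaryData (u f : H) (e g : E) : Prop :=
  ∃ φ : T.Lam.domain, u = T.A₀inv f + T.Pi φ ∧ (φ : E) = e ∧ g = T.Pi.adjoint f + T.Lam φ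

variable {T}

/-- Replaces three partially defined operators by one relation without membership proofs, which can
be added and scaled freely. -/
theorem boundaryData_iff {u f : H} {e g : E} : T.BoundaryData u f e g ↔
    ∃ hu : u ∈ T.Γ₁.domain, T.A ⟨u, T.Γ₁_domain_le_A hu⟩ = f ∧
      T.Γ₀ ⟨u, T.Γ₁_domain_le_Γ₀ hu⟩ = e ∧ T.Γ₁ ⟨u, hu⟩ = g := by
  have key : ∀ (f : H) (φ : T.Lam.domain),
      ∃ hu : T.A₀inv f + T.Pi φ ∈ T.Γ₁.domain, T.A ⟨_, T.Γ₁_domain_le_A hu⟩ = f ∧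
      T.Γ₀ ⟨_, T.Γ₁_domain_le_Γ₀ hu⟩ = φ ∧ T.Γ₁ ⟨_, hu⟩ = T.Pi.adjoint f + T.Lam φ := by
    intro f φ
    have hu : T.A₀inv f + T.Pi φ ∈ T.Γ₁.domain := ⟨(f, φ), rfl⟩
    have hA : T.compose ⊤ (f, ⟨φ, trivial⟩) ∈
        LinearMap.range (T.compose (⊤ : Submodule ℂ E)) := ⟨_, rfl⟩
    exact ⟨hu, T.ofDecomposition_apply ⊤ _ (f, ⟨φ, trivial⟩) hA,
      T.ofDecomposition_apply ⊤ _ (f, ⟨φ, trivial⟩) hA,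
      T.ofDecomposition_apply T.Lam.domain _ (f, φ) hu⟩
  constructor
  · rintro ⟨φ, rfl, rfl, rfl⟩
    exact key f φ
  · rintro ⟨⟨⟨f', φ⟩, rfl⟩, rfl, rfl, rfl⟩
    obtain ⟨hu, h1, h2, h3⟩ := key f' φ
    have e1 : T.A ⟨T.compose T.Lam.domain (f', φ), T.Γ₁_domain_le_A hu⟩ = f' := h1
    have e2 : T.Γ₀ ⟨T.compose T.Lam.domain (f', φ), T.Γ₁_domain_le_Γ₀ hu⟩ = φ := h2
    have e3 : T.Γ₁ ⟨T.compose T.Lam.domain (f', φ), hu⟩ = T.Pi.adjoint f' + T.Lam φ := h3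
    rw [e1, e2, e3]
    exact ⟨φ, rfl, rfl, rfl⟩

theorem BoundaryData.add {u f u' f' : H} {e g e' g' : E} (h : T.BoundaryData u f e g)
    (h' : T.BoundaryData u' f' e' g') : T.BoundaryData (u + u') (f + f') (e + e') (g + g') := by
  obtain ⟨φ, rfl, rfl, rfl⟩ := h
  obtain ⟨φ', rfl, rfl, rfl⟩ := h'
  refine ⟨φ + φ', ?_, rfl, ?_⟩
  · rw [Submodule.coe_add, map_add, map_add]; abel
  · rw [LinearPMap.map_add, map_add]; abel

theorem BoundaryData.smul {u f : H} {e g : E} (c : ℂ) (h : T.BoundaryData u f e g) :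
    T.BoundaryData (c • u) (c • f) (c • e) (c • g) := by
  obtain ⟨φ, rfl, rfl, rfl⟩ := h
  refine ⟨c • φ, ?_, rfl, ?_⟩
  · rw [Submodule.coe_smul, map_smul, map_smul, smul_add]
  · rw [LinearPMap.map_smul, map_smul, smul_add]

theorem inner_A₀inv (f g : H) : inner ℂ (T.A₀inv f) g = inner ℂ f (T.A₀inv g) := by
  have h := inner_symm_of_isSelfAdjoint T.isSelfAdjoint_A₀ ⟨_, T.A₀inv_mem f⟩ ⟨_, T.A₀inv_mem g⟩
  rw [T.A₀_A₀inv, T.A₀_A₀inv] at h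
  exact h.symm

theorem inner_A₀inv_self_im (f : H) : (inner ℂ (T.A₀inv f) f).im = 0 := by
  have h := T.inner_A₀inv f f
  rw [← inner_conj_symm f] at h
  exact Complex.conj_eq_iff_im.1 h.symm

/-- Green's formula. -/
theorem BoundaryData.green {u f u' f' : H} {e g e' g' : E} (h : T.BoundaryData u f e g)
    (h' : T.BoundaryData u' f' e' g') :
    inner ℂ f u' - inner ℂ u f' = inner ℂ g e' - inner ℂ e g' := by
  obtain ⟨φ, rfl, rfl, rfl⟩ := h
  obtain ⟨φ', rfl, rfl, rfl⟩ := h'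
  -- The terms in `A₀⁻¹` and in `Λ` cancel by symmetry; those in `Π` and `Π*` match in pairs.
  simp only [inner_add_left, inner_add_right, ContinuousLinearMap.adjoint_inner_left,
    ContinuousLinearMap.adjoint_inner_right, inner_A₀inv,
    inner_symm_of_isSelfAdjoint T.isSelfAdjoint_Lam φ φ']
  ring

theorem BoundaryData.inner_im {u f : H} {e g : E} (h : T.BoundaryData u f e g) :
    (inner ℂ u f).im = (inner ℂ e g).im := by
  have h1 := congrArg Complex.im (h.green h)
  rw [← inner_conj_symm f, ← inner_conj_symm g, Complex.sub_im, Complex.sub_im, Complex.conj_im,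
    Complex.conj_im] at h1
  linarith

theorem A₀_resolvent {z : ℂ} (hz : z ∈ resolventSetOp T.A₀) (h : H) :
    T.A₀ ⟨resolventOp T.A₀ z h, T.resolvent_A₀_mem z h⟩ = h + z • resolventOp T.A₀ z h := by
  obtain ⟨_, h2⟩ := (boundedInverse_spec hz).2 h
  exact sub_eq_iff_eq_add.1 h2

theorem resolvent_sub {z : ℂ} (hz : z ∈ resolventSetOp T.A₀) (u : T.A₀.domain) :
    resolventOp T.A₀ z (T.A₀ u - z • (u : H)) = u := (boundedInverse_spec hz).1 u

theorem boundaryData_resolvent {z : ℂ} (hz : z ∈ resolventSetOp T.A₀) (h : H) :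
    T.BoundaryData (resolventOp T.A₀ z h) (h + z • resolventOp T.A₀ z h) 0
      (T.Pi.adjoint (h + z • resolventOp T.A₀ z h)) := by
  refine ⟨0, ?_, rfl, ?_⟩
  · rw [← A₀_resolvent hz, T.A₀inv_A₀, Submodule.coe_zero, map_zero, add_zero]
  · rw [LinearPMap.map_zero, add_zero]

/-- Since `A₀ (A₀ - z)⁻¹ Π = γ(z)`, the summand `z (A₀ - z)⁻¹ Π e` of `γ(z) e` equals `A₀⁻¹ (z γ(z)
e)`. -/
theorem γ_eq {z : ℂ} (hz : z ∈ resolventSetOp T.A₀) (e : E) :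
    T.γ z e = T.A₀inv (z • T.γ z e) + T.Pi e := by
  have e1 : T.γ z e = T.Pi e + z • resolventOp T.A₀ z (T.Pi e) := rfl
  have e2 : T.A₀ ⟨resolventOp T.A₀ z (T.Pi e), T.resolvent_A₀_mem z _⟩ = T.γ z e := by
    rw [A₀_resolvent hz, e1]
  have e3 : T.A₀inv (T.γ z e) = resolventOp T.A₀ z (T.Pi e) := by rw [← e2, T.A₀inv_A₀]
  rw [map_smul, e3, e1, add_comm]

theorem boundaryData_γ {z : ℂ} (hz : z ∈ resolventSetOp T.A₀) (e : T.Lam.domain) :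
    T.BoundaryData (T.γ z e) (z • T.γ z e) e (T.M z e) := by
  have h : T.BoundaryData (T.γ z e) (z • T.γ z e) e
      (T.Pi.adjoint (z • T.γ z e) + T.Lam e) := ⟨e, γ_eq hz e, rfl, rfl⟩
  obtain ⟨hu, -, -, h3⟩ := boundaryData_iff.1 h
  have h4 : T.M z e = T.Γ₁ ⟨T.γ z e, hu⟩ := rfl
  rw [h4, h3]
  exact h

/-- Exhibits `M(z)` as a bounded perturbation of the self-adjoint `Λ`, so that
`HasBoundedInverse.of_isSelfAdjoint_add` applies. -/
theorem M_apply {z : ℂ} (hz : z ∈ resolventSetOp T.A₀) (e : T.Lam.domain) :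
    T.M z e = T.Lam e + T.Pi.adjoint (z • T.γ z e) := by
  obtain ⟨φ, -, h2, h3⟩ := boundaryData_γ hz e
  obtain rfl : φ = e := Subtype.ext h2
  rw [h3, add_comm]

/-- The form `⟨A₀⁻¹ x, x⟩` is real, so only the `Π e` part of `γ(z) e` contributes. The vector `e`
ranges over all of `E`, not only `dom Λ`, because the invertibility criterion needs definiteness of
the bounded part everywhere. -/
theorem inner_adjoint_γ_im {z : ℂ} (hz : z ∈ resolventSetOp T.A₀) (e : E) :
    (inner ℂ e (T.Pi.adjoint (z • T.γ z e))).im = z.im * ‖T.γ z e‖ ^ 2 := by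
  have h1 : inner ℂ (T.γ z e) (z • T.γ z e) = inner ℂ (T.A₀inv (z • T.γ z e)) (z • T.γ z e) +
      inner ℂ (T.Pi e) (z • T.γ z e) := by
    rw [← inner_add_left, ← γ_eq hz]
  have h2 := inner_sub_smul_im (T.γ z e) 0 (-z)
  rw [neg_smul, sub_neg_eq_add, zero_add, h1, Complex.add_im, inner_A₀inv_self_im,
    inner_zero_right, Complex.zero_im, zero_add, zero_sub, Complex.neg_im, neg_mul, neg_neg] at h2
  rw [ContinuousLinearMap.adjoint_inner_right, h2]

theorem mem_resolventSetOp_A₀ {z : ℂ} (hz : z.im ≠ 0) : z ∈ resolventSetOp T.A₀ :=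
  mem_resolventSetOp_of_isSelfAdjoint T.isSelfAdjoint_A₀ hz

/-- `M(z) - w I` is boundedly invertible if `z` and `w` lie in different open half-planes. -/
theorem hasBoundedInverse_M_sub {z w : ℂ} (hzw : z.im * w.im < 0) :
    HasBoundedInverse (subScalar (T.M z) w) := by
  have hz : z.im ≠ 0 := left_ne_zero_of_mul hzw.ne
  have hw : w.im ≠ 0 := right_ne_zero_of_mul hzw.ne
  have hz' := T.mem_resolventSetOp_A₀ hz
  refine HasBoundedInverse.of_isSelfAdjoint_add T.isSelfAdjoint_Lam
    (T.Pi.adjoint ∘L (z • T.γ z) - w • ContinuousLinearMap.id ℂ E) rfl (fun x h h' => ?_)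
    (abs_pos.2 hw) fun x => ?_
  · exact (congrArg (· - w • x) (M_apply hz' ⟨x, h'⟩)).trans (add_sub_assoc _ _ _)
  · have h1 := inner_sub_smul_im x (T.Pi.adjoint (z • T.γ z x)) w
    rw [inner_adjoint_γ_im hz'] at h1
    have h2 : (T.Pi.adjoint ∘L (z • T.γ z) - w • ContinuousLinearMap.id ℂ E) x =
      T.Pi.adjoint (z • T.γ z x) - w • x := rfl
    rw [h2, h1]
    have ha : 0 ≤ ‖T.γ z x‖ ^ 2 := sq_nonneg _
    have hb : 0 ≤ ‖x‖ ^ 2 := sq_nonneg _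
    rcases lt_or_gt_of_ne hw with h | h
    · have h3 : 0 < z.im := pos_of_mul_neg_left hzw h.le
      rw [abs_of_neg h]
      exact le_trans (by nlinarith [mul_nonneg h3.le ha]) (le_abs_self _)
    · have h3 : z.im < 0 := neg_of_mul_neg_left hzw h.le
      rw [abs_of_pos h]
      exact le_trans (by nlinarith [mul_nonneg (neg_nonneg.2 h3.le) ha]) (neg_le_abs _)

/-- Green's formula for `γ(conj z) x` and `γ(z) y`: the spectral parameters are conjugate, so the
terms in `H` cancel and only the boundary terms remain. -/
theorem isFormalAdjoint_M_sub {z : ℂ} (hz : z ∈ resolventSetOp T.A₀)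
    (hz' : conj z ∈ resolventSetOp T.A₀) (w : ℂ) :
    (subScalar (T.M (conj z)) (conj w)).IsFormalAdjoint (subScalar (T.M z) w) := by
  rintro ⟨x, hx⟩ ⟨y, hy⟩
  have h := (boundaryData_γ hz' ⟨x, hx⟩).green (boundaryData_γ hz ⟨y, hy⟩)
  rw [inner_smul_left, inner_smul_right, Complex.conj_conj, sub_self, eq_comm, sub_eq_zero] at h
  have e1 : subScalar (T.M (conj z)) (conj w) ⟨x, hx⟩ = T.M (conj z) ⟨x, hx⟩ - conj w • x := rfl
  have e2 : subScalar (T.M z) w ⟨y, hy⟩ = T.M z ⟨y, hy⟩ - w • y := rfl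
  rw [e1, e2]
  simp only [inner_sub_left, inner_sub_right, inner_smul_left, inner_smul_right,
    Complex.conj_conj]
  exact congrArg (· - w * inner ℂ x y) h

theorem adjoint_boundedInverse_M_sub {z w : ℂ} (hzw : z.im * w.im < 0) :
    (boundedInverse (subScalar (T.M (conj z)) (conj w))).adjoint =
      boundedInverse (subScalar (T.M z) w) := by
  have hz : z.im ≠ 0 := left_ne_zero_of_mul hzw.ne
  have hz' : (conj z).im ≠ 0 := by rwa [Complex.conj_im, neg_ne_zero]
  refine IsBoundedInverse.adjoint_eq (boundedInverse_spec (hasBoundedInverse_M_sub ?_))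
    (boundedInverse_spec (hasBoundedInverse_M_sub hzw))
    (isFormalAdjoint_M_sub (T.mem_resolventSetOp_A₀ hz) (T.mem_resolventSetOp_A₀ hz') w)
  rwa [Complex.conj_im, Complex.conj_im, neg_mul_neg]

theorem adjoint_resolvent_A₀ {z : ℂ} (hz : z ∈ resolventSetOp T.A₀)
    (hz' : conj z ∈ resolventSetOp T.A₀) :
    (resolventOp T.A₀ (conj z)).adjoint = resolventOp T.A₀ z := by
  refine IsBoundedInverse.adjoint_eq (boundedInverse_spec hz') (boundedInverse_spec hz) ?_
  rintro ⟨x, hx⟩ ⟨y, hy⟩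
  have h := inner_symm_of_isSelfAdjoint T.isSelfAdjoint_A₀ ⟨x, hx⟩ ⟨y, hy⟩
  have e1 : subScalar T.A₀ (conj z) ⟨x, hx⟩ = T.A₀ ⟨x, hx⟩ - conj z • x := rfl
  have e2 : subScalar T.A₀ z ⟨y, hy⟩ = T.A₀ ⟨y, hy⟩ - z • y := rfl
  rw [e1, e2]
  simp only [inner_sub_left, inner_sub_right, inner_smul_left, inner_smul_right,
    Complex.conj_conj]
  rw [h]

variable (T)

/-- The operator `(A₀ - z)⁻¹ - γ(z) (M(z) - w)⁻¹ Π* (I + z (A₀ - z)⁻¹)`, which solves the problem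
`(A - z) u = h`, `Γ₁ u = w Γ₀ u`. -/
noncomputable def kreinResolvent (z w : ℂ) : H →L[ℂ] H :=
  resolventOp T.A₀ z - T.γ z ∘L boundedInverse (subScalar (T.M z) w) ∘L T.Pi.adjoint ∘L
    (ContinuousLinearMap.id ℂ H + z • resolventOp T.A₀ z)

/-- The value of `Γ₀` on the solution of the problem `(A - z) u = h`, `Γ₁ u = w Γ₀ u`. -/
noncomputable def kreinTrace (z w : ℂ) (h : H) : E :=
  -boundedInverse (subScalar (T.M z) w) (T.Pi.adjoint (h + z • resolventOp T.A₀ z h))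

variable {T}

theorem kreinResolvent_apply (z w : ℂ) (h : H) :
    T.kreinResolvent z w h = resolventOp T.A₀ z h + T.γ z (T.kreinTrace z w h) := by
  rw [kreinTrace, map_neg, ← sub_eq_add_neg]
  rfl

/-- The solution of the problem `(A - z) u = h`, `Γ₁ u - w Γ₀ u = b`. -/
theorem boundaryData_krein {z w : ℂ} (hz : z ∈ resolventSetOp T.A₀)
    (hM : HasBoundedInverse (subScalar (T.M z) w)) (h : H) (b : E) :
    T.BoundaryData
      (T.kreinResolvent z w h + T.γ z (boundedInverse (subScalar (T.M z) w) b))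
      (h + z • (T.kreinResolvent z w h + T.γ z (boundedInverse (subScalar (T.M z) w) b)))
      (T.kreinTrace z w h + boundedInverse (subScalar (T.M z) w) b)
      (w • (T.kreinTrace z w h + boundedInverse (subScalar (T.M z) w) b) + b) := by
  set K := boundedInverse (subScalar (T.M z) w) with hK
  set q := T.Pi.adjoint (h + z • resolventOp T.A₀ z h) with hq
  -- The term `(A₀ - z)⁻¹ h` contributes `q` to `Γ₁` and nothing to `Γ₀`, while `γ(z) ψ` contributes
  -- `M(z) ψ` and `ψ`. The condition becomes `(M(z) - w) ψ = b - q`.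
  have he : T.kreinTrace z w h + K b = K (b - q) := by
    rw [kreinTrace, ← hK, map_sub, ← hq]; abel
  have hu : T.kreinResolvent z w h + T.γ z (K b) = resolventOp T.A₀ z h + T.γ z (K (b - q)) := by
    rw [kreinResolvent_apply, add_assoc, ← map_add, he]
  obtain ⟨hm, hm'⟩ : ∃ hm : K (b - q) ∈ T.Lam.domain,
    subScalar (T.M z) w ⟨K (b - q), hm⟩ = b - q := (boundedInverse_spec hM).2 (b - q)
  have hm'' : T.M z ⟨K (b - q), hm⟩ = b - q + w • K (b - q) := sub_eq_iff_eq_add.1 hm'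
  have hd : T.BoundaryData (T.γ z (K (b - q))) (z • T.γ z (K (b - q))) (K (b - q))
      (b - q + w • K (b - q)) :=
    (congrArg (T.BoundaryData _ _ _) hm'').mp (boundaryData_γ hz ⟨K (b - q), hm⟩)
  have key := (boundaryData_resolvent hz h).add hd
  rw [zero_add, ← hq] at key
  rw [hu, he]
  convert key using 1
  · rw [smul_add, add_assoc]
  · abel

theorem boundaryData_kreinResolvent {z w : ℂ} (hz : z ∈ resolventSetOp T.A₀)
    (hM : HasBoundedInverse (subScalar (T.M z) w)) (h : H) :
    T.BoundaryData (T.kreinResolvent z w h) (h + z • T.kreinResolvent z w h)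
      (T.kreinTrace z w h) (w • T.kreinTrace z w h) := by
  have := boundaryData_krein hz hM h 0
  simpa only [map_zero, add_zero] using this

/-- Uniqueness for the problem `(A - z) u = h`, `Γ₁ u = w Γ₀ u`. -/
theorem BoundaryData.eq_kreinResolvent {z w : ℂ} (hz : z ∈ resolventSetOp T.A₀)
    (hM : HasBoundedInverse (subScalar (T.M z) w)) {u f : H} {e : E}
    (h : T.BoundaryData u f e (w • e)) : T.kreinResolvent z w (f - z • u) = u := by
  obtain ⟨φ, h1, rfl, h3⟩ := id h
  -- Subtracting `γ(z) φ` removes the `Γ₀`-trace, leaving an element of `dom A₀` on which the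
  -- resolvent of `A₀` is available.
  have key := h.add ((boundaryData_γ hz φ).smul (-1))
  simp only [neg_smul, one_smul, ← sub_eq_add_neg, sub_self] at key
  obtain ⟨ψ, k1, k2, k3⟩ := key
  obtain rfl : ψ = 0 := Subtype.ext k2
  rw [Submodule.coe_zero, map_zero, add_zero] at k1
  rw [LinearPMap.map_zero, add_zero] at k3
  set p := f - z • T.γ z φ with hp
  have hR : resolventOp T.A₀ z (f - z • u) = u - T.γ z φ := by
    have h5 := resolvent_sub hz ⟨_, T.A₀inv_mem p⟩
    rw [T.A₀_A₀inv] at h5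
    rw [k1]
    have h6 : f - z • u = p - z • T.A₀inv p := by
      rw [← k1, hp, smul_sub]; abel
    rw [h6]
    exact h5
  have hp' : f - z • u + z • resolventOp T.A₀ z (f - z • u) = p := by
    rw [hR, smul_sub, hp]; abel
  have ht : T.kreinTrace z w (f - z • u) = φ := by
    have h7 : T.M z φ - w • (φ : E) = -T.Pi.adjoint p :=
      (neg_sub _ _).symm.trans (congrArg Neg.neg k3)
    have h8 : boundedInverse (subScalar (T.M z) w) (T.M z φ - w • (φ : E)) = φ :=
      (boundedInverse_spec hM).1 φ
    rw [h7, map_neg] at h8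
    rw [kreinTrace, hp']
    exact h8
  rw [kreinResolvent_apply, ht, hR, sub_add_cancel]

variable (T) in
-- `Λ - i` is a bounded perturbation of a closed operator, hence already closed, and the closure in
-- the definition of `A_{αβ}` adds nothing.
theorem bdryClosure_eq : T.bdryClosure ((-Complex.I • LinearMap.id (R := ℂ) (M := E)).toPMap ⊤)
      (ContinuousLinearMap.id ℂ E) =
    (-Complex.I • LinearMap.id (R := ℂ) (M := E)).toPMap ⊤ +
      (ContinuousLinearMap.id ℂ E).toLinearMap.compPMap T.Lam := by
  set C := (-Complex.I • LinearMap.id (R := ℂ) (M := E)).toPMap ⊤ +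
    (ContinuousLinearMap.id ℂ E).toLinearMap.compPMap T.Lam with hC
  have hcl : C.IsClosed := by
    have hL : IsClosed (T.Lam.graph : Set (E × E)) := T.isSelfAdjoint_Lam.isClosed
    have e : (C.graph : Set (E × E)) =
        (fun p : E × E => (p.1, p.2 - (-Complex.I • p.1))) ⁻¹' T.Lam.graph := by
      ext ⟨a, b⟩
      simp only [SetLike.mem_coe, LinearPMap.mem_graph_iff, mem_preimage]
      constructor
      · rintro ⟨⟨x, hx⟩, h1, h2⟩
        obtain rfl : x = a := h1
        have h3 : -Complex.I • x + T.Lam ⟨x, hx.2⟩ = b := h2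
        exact ⟨⟨x, hx.2⟩, rfl, eq_sub_of_add_eq' h3⟩
      · rintro ⟨⟨x, hx⟩, h1, h2⟩
        obtain rfl : x = a := h1
        exact ⟨⟨x, trivial, hx⟩, rfl, (eq_sub_iff_add_eq'.1 h2 :
          -Complex.I • x + T.Lam ⟨x, hx⟩ = b)⟩
    change IsClosed (C.graph : Set (E × E))
    rw [e]
    exact hL.preimage (by fun_prop)
  refine LinearPMap.eq_of_eq_graph ?_
  have h := hcl.isClosable.graph_closure_eq_closure_graph
  rw [hcl.submodule_topologicalClosure_eq] at h
  exact h.symm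

/-! ### The operator `L`, its resolvent and its adjoint -/

/-- With the closure removed, the kernel condition `Π* f + Λ φ - i φ = 0` is `Γ₁ u = i Γ₀ u`. -/
theorem L_iff {u f : H} : (∃ hu : u ∈ T.L.domain, T.L ⟨u, hu⟩ = f) ↔
    ∃ e, T.BoundaryData u f e (Complex.I • e) := by
  set C := T.bdryClosure ((-Complex.I • LinearMap.id (R := ℂ) (M := E)).toPMap ⊤)
    (ContinuousLinearMap.id ℂ E) with hC
  have hCe := T.bdryClosure_eq
  rw [← hC] at hCe
  have hval : ∀ (φ : E) (h : φ ∈ C.domain) (h' : φ ∈ T.Lam.domain),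
      C ⟨φ, h⟩ = -Complex.I • φ + T.Lam ⟨φ, h'⟩ := fun φ h h' =>
    hCe.le.2 (x := ⟨φ, h⟩) (y := ⟨φ, trivial, h'⟩) rfl
  have hdom : ∀ φ : E, φ ∈ C.domain ↔ φ ∈ T.Lam.domain := fun φ =>
    ⟨fun h => (hCe.le.1 h).2, fun h => hCe.ge.1 ⟨trivial, h⟩⟩
  constructor
  · rintro ⟨⟨⟨⟨_, ⟨f', φ, hφ⟩, rfl⟩, hk, hu⟩, hA⟩, hf⟩
    have hφ' : φ ∈ T.Lam.domain := (hdom φ).1 hφ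
    have h1 : T.A₀inv f' + T.Pi φ = u := hu
    have h2 := (T.ofDecomposition_apply C.domain _ (f', ⟨φ, hφ⟩) ⟨_, rfl⟩).symm.trans hk
    have h3 : T.Pi.adjoint f' + C ⟨φ, hφ⟩ = 0 := h2
    rw [hval φ hφ hφ', neg_smul, add_left_comm, neg_add_eq_zero] at h3
    have hd : T.BoundaryData u f' φ (Complex.I • φ) := ⟨⟨φ, hφ'⟩, h1.symm, rfl, h3⟩
    obtain ⟨hu', h4, -, -⟩ := boundaryData_iff.1 hd
    have h5 : T.A ⟨u, T.Γ₁_domain_le_A hu'⟩ = f := hf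
    rw [h4] at h5
    rw [← h5]
    exact ⟨φ, hd⟩
  · rintro ⟨e, hd⟩
    obtain ⟨hu', h4, -, -⟩ := boundaryData_iff.1 hd
    obtain ⟨φ, rfl, rfl, h3⟩ := hd
    have hφ : (φ : E) ∈ C.domain := (hdom φ).2 φ.2
    refine ⟨⟨⟨⟨_, ⟨f, ⟨φ, hφ⟩⟩, rfl⟩, ?_, rfl⟩, T.Γ₁_domain_le_A hu'⟩, h4⟩
    refine (T.ofDecomposition_apply C.domain _ (f, ⟨φ, hφ⟩) ⟨_, rfl⟩).trans ?_
    change T.Pi.adjoint f + C ⟨φ, hφ⟩ = 0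
    rw [hval φ hφ φ.2, neg_smul, add_left_comm, neg_add_eq_zero]
    exact h3

theorem isBoundedInverse_L_sub {z : ℂ} (hz : z ∈ resolventSetOp T.A₀)
    (hM : HasBoundedInverse (subScalar (T.M z) Complex.I)) :
    IsBoundedInverse (subScalar T.L z) (T.kreinResolvent z Complex.I) := by
  constructor
  · rintro ⟨u, hu⟩
    obtain ⟨e, he⟩ := L_iff.1 ⟨hu, rfl⟩
    exact he.eq_kreinResolvent hz hM
  · intro h
    obtain ⟨hu, h'⟩ := L_iff.2 ⟨_, boundaryData_kreinResolvent hz hM h⟩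
    exact ⟨hu, sub_eq_of_eq_add h'⟩

/-- On `dom L` Green's formula gives `Im ⟨u, L u⟩ = Im ⟨e, i e⟩ = ‖e‖²` with `e = Γ₀ u`. -/
theorem L_dissipative (u : T.L.domain) : 0 ≤ (inner ℂ (u : H) (T.L u)).im := by
  obtain ⟨e, he⟩ := L_iff.1 ⟨u.2, rfl⟩
  have h1 := inner_sub_smul_im e 0 (-Complex.I)
  rw [neg_smul, sub_neg_eq_add, zero_add, inner_zero_right, Complex.zero_im, zero_sub,
    Complex.neg_im, Complex.I_im, neg_mul, neg_neg, one_mul] at h1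
  have h2 := he.inner_im
  rw [h1] at h2
  exact h2 ▸ sq_nonneg _

theorem isBoundedInverse_L_sub_of_im_neg {z : ℂ} (hz : z.im < 0) :
    IsBoundedInverse (subScalar T.L z) (T.kreinResolvent z Complex.I) :=
  isBoundedInverse_L_sub (T.mem_resolventSetOp_A₀ hz.ne)
    (hasBoundedInverse_M_sub (by simpa using hz))

theorem isMaximalDissipative_L : IsMaximalDissipative T.L := by
  have h : (-Complex.I).im < 0 := by simp
  refine ⟨dense_of_dissipative L_dissipative h fun y => ?_, L_dissipative,
    fun z hz => ⟨_, isBoundedInverse_L_sub_of_im_neg hz⟩⟩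
  obtain ⟨h1, h2⟩ := (isBoundedInverse_L_sub_of_im_neg (T := T) h).2 y
  exact ⟨_, h2⟩

/-- Writing `γ(z) = (I + z (A₀ - z)⁻¹) Π`, taking adjoints exchanges the outer factors of the
correction term and conjugates the parameters of the middle one. -/
theorem adjoint_kreinResolvent {z w : ℂ} (hzw : z.im * w.im < 0) :
    (T.kreinResolvent (conj z) (conj w)).adjoint = T.kreinResolvent z w := by
  have hz : z.im ≠ 0 := left_ne_zero_of_mul hzw.ne
  have hz' : (conj z).im ≠ 0 := by rwa [Complex.conj_im, neg_ne_zero]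
  have hR := adjoint_resolvent_A₀ (T.mem_resolventSetOp_A₀ hz) (T.mem_resolventSetOp_A₀ hz')
  have hK := T.adjoint_boundedInverse_M_sub hzw
  rw [kreinResolvent, kreinResolvent, map_sub, hR]
  congr 1
  have hγ : ∀ z, T.γ z = (ContinuousLinearMap.id ℂ H + z • resolventOp T.A₀ z) ∘L T.Pi := by
    intro z; ext e; rfl
  have hid : (ContinuousLinearMap.id ℂ H).adjoint = ContinuousLinearMap.id ℂ H :=
    ContinuousLinearMap.adjoint_id
  rw [hγ, hγ]
  simp only [ContinuousLinearMap.adjoint_comp, ContinuousLinearMap.adjoint_adjoint, map_add, hid,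
    LinearIsometryEquiv.map_smulₛₗ, Complex.conj_conj, hR, hK]
  rfl

/-- The resolvent of `L*` is the adjoint of that of `L`, so no description of `dom L*` is needed. -/
theorem isBoundedInverse_adjoint_L_sub {z : ℂ} (hz : 0 < z.im) :
    IsBoundedInverse (subScalar T.L.adjoint z) (T.kreinResolvent z (-Complex.I)) := by
  have h : (conj z).im < 0 := by rwa [Complex.conj_im, neg_lt_zero]
  have h1 := (isBoundedInverse_L_sub_of_im_neg (T := T) h).adjoint T.isMaximalDissipative_L.1
  have h2 := T.adjoint_kreinResolvent (z := z) (w := -Complex.I) (by simpa using hz)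
  rw [map_neg, Complex.conj_I, neg_neg] at h2
  rwa [h2] at h1

end RyzhovTriple

/-! ### Solving the resolvent equations on the half-lines -/

namespace UnboundedOp

theorem resolventOp_mem_graph {V : Type*} [NormedAddCommGroup V] [NormedSpace ℂ V]
    {T : V →ₗ.[ℂ] V} {z : ℂ} (hz : z ∈ resolventSetOp T) (y : V) :
    (resolventOp T z y, y) ∈ (subScalar T z).graph := by
  obtain ⟨h1, h2⟩ := (boundedInverse_spec hz).2 y
  exact (LinearPMap.mem_graph_iff _).2 ⟨⟨_, h1⟩, rfl, h2⟩

theorem resolventOp_apply_eq {V : Type*} [NormedAddCommGroup V] [NormedSpace ℂ V]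
    {T : V →ₗ.[ℂ] V} {z : ℂ} (hz : z ∈ resolventSetOp T) {x y : V} (hx : x ∈ T.domain)
    (h : T ⟨x, hx⟩ - z • x = y) : resolventOp T z y = x := by
  rw [← h]
  exact (boundedInverse_spec hz).1 ⟨x, hx⟩

end UnboundedOp

namespace HalfLine

variable {E : Type*} [NormedAddCommGroup E] [InnerProductSpace ℂ E] [CompleteSpace E]
  {s : Set ℝ} {σ : ℝ}

theorem IsHalfLine.isWeakDeriv_resolvent_momentum (hs : IsHalfLine E s σ) {z : ℂ}
    (hz : σ * z.im < 0) (y : L2 E s) : IsWeakDeriv (resolventOp (momentum E s) z y)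
      (-Complex.I • (y + z • resolventOp (momentum E s) z y)) :=
  (mem_graph_momentum_sub hs.isOpen z _ _).1
    (resolventOp_mem_graph (hs.mem_resolventSetOp_momentum hz) y)

/-- The solutions of `i v' - z v = y` with a given boundary value. -/
theorem IsHalfLine.exists_solution (hs : IsHalfLine E s σ) {z : ℂ} (hz : 0 < σ * z.im)
    (y : L2 E s) (e : E) : ∃ v : L2 E s,
      (∀ᵐ x ∂volume.restrict s, v x = resolventOp (momentumZero E s) z y x +
        Complex.exp (-Complex.I * z * x) • e) ∧
      IsWeakDeriv v (-Complex.I • (y + z • v)) ∧ HasBoundaryValue v e := by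
  obtain ⟨p, h1, h2, h3⟩ := hs.exists_exp hz e
  have h4 := (mem_graph_momentumZero_sub hs.isOpen z _ _).1
    (resolventOp_mem_graph (hs.mem_resolventSetOp_momentumZero hz) y)
  refine ⟨resolventOp (momentumZero E s) z y + p, ?_, ?_, ?_⟩
  · filter_upwards [Lp.coeFn_add (resolventOp (momentumZero E s) z y) p, h1] with x hx hx1
    rw [hx, Pi.add_apply, hx1]
  · have h5 := (weakDerivGraph s).add_mem (closure_testGraph_le s h4)
      (show (p, -Complex.I • (z • p)) ∈ weakDerivGraph s from h2)
    rw [Prod.mk_add_mk, ← smul_add, add_assoc, ← smul_add] at h5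
    exact h5
  · simpa only [zero_add] using (hs.hasBoundaryValue_zero h4).add h3

end HalfLine

/-! ### The dilation: symmetry, solvability, self-adjointness -/

namespace RyzhovTriple

open HalfLine

variable {H E : Type*} [NormedAddCommGroup H] [InnerProductSpace ℂ H] [CompleteSpace H]
  [NormedAddCommGroup E] [InnerProductSpace ℂ E] [CompleteSpace E] {T : RyzhovTriple H E}

theorem dilation_iff {vm wm : L2 E (Iio 0)} {u f : H} {vp wp : L2 E (Ioi 0)} :
    (∃ hx : triple vm u vp ∈ T.dilation.domain,
      T.dilation ⟨_, hx⟩ = triple (Complex.I • wm) f (Complex.I • wp)) ↔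
    IsWeakDeriv vm wm ∧ IsWeakDeriv vp wp ∧ ∃ e g em ep, T.BoundaryData u f e g ∧
      HasBoundaryValue vm em ∧ HasBoundaryValue vp ep ∧
      g + Complex.I • e = ((√2 : ℝ) : ℂ) • ep ∧ g - Complex.I • e = ((√2 : ℝ) : ℂ) • em := by
  constructor
  · rintro ⟨⟨h1, h2, hu, em, ep, h3, h4, h5, h6⟩, hD⟩
    have k1 := congrArg (fun x : DilationSpace H E => x.fst) hD
    have k2 := congrArg (fun x : DilationSpace H E => x.snd.fst) hD
    have k3 := congrArg (fun x : DilationSpace H E => x.snd.snd) hD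
    have k1' : sobolevDeriv E (Iio 0) ⟨vm, h1⟩ = wm := smul_right_injective _ Complex.I_ne_zero k1
    have k3' : sobolevDeriv E (Ioi 0) ⟨vp, h2⟩ = wp := smul_right_injective _ Complex.I_ne_zero k3
    refine ⟨?_, ?_, _, _, em, ep, boundaryData_iff.2 ⟨hu, k2, rfl, rfl⟩, h3, h4, h5, h6⟩
    · rw [← k1']
      exact isWeakDeriv_sobolevDeriv isOpen_Iio ⟨vm, h1⟩
    · rw [← k3']
      exact isWeakDeriv_sobolevDeriv isOpen_Ioi ⟨vp, h2⟩
  · rintro ⟨h1, h2, e, g, em, ep, h3, h4, h5, h6, h7⟩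
    obtain ⟨hu, k1, rfl, rfl⟩ := boundaryData_iff.1 h3
    obtain ⟨m1, k2⟩ := h1.sobolevDeriv_eq isOpen_Iio
    obtain ⟨m2, k3⟩ := h2.sobolevDeriv_eq isOpen_Ioi
    refine ⟨⟨m1, m2, hu, em, ep, h4, h5, h6, h7⟩, ?_⟩
    rw [← k1, ← k2, ← k3]
    rfl

theorem exists_dilation_data (x : T.dilation.domain) :
    ∃ (vm wm : L2 E (Iio 0)) (u f : H) (vp wp : L2 E (Ioi 0)),
      (x : DilationSpace H E) = triple vm u vp ∧
      T.dilation x = triple (Complex.I • wm) f (Complex.I • wp) :=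
  ⟨_, _, _, _, _, _, rfl, rfl⟩

/-- The half-lines contribute `(‖v₋(0)‖² - ‖v₊(0)‖²) / 2`, and the middle component contributes `Im
⟨Γ₀ u, Γ₁ u⟩`, which by polarization and the boundary conditions is the opposite. -/
theorem dilation_inner_im (x : T.dilation.domain) :
    (inner ℂ (x : DilationSpace H E) (T.dilation x)).im = 0 := by
  obtain ⟨vm, wm, u, f, vp, wp, h1, h2⟩ := exists_dilation_data x
  obtain ⟨x, hx⟩ := x
  obtain rfl : x = triple vm u vp := h1
  obtain ⟨k1, k2, e, g, em, ep, k3, k4, k5, k6, k7⟩ := dilation_iff.1 ⟨hx, h2⟩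
  rw [h2]
  have q1 := isHalfLine_Iio.two_mul_re_inner k1 k4
  have q2 := isHalfLine_Ioi.two_mul_re_inner k2 k5
  have q3 := k3.inner_im
  have q4 : inner ℂ (triple vm u vp : DilationSpace H E)
      (triple (Complex.I • wm) f (Complex.I • wp)) =
      inner ℂ vm (Complex.I • wm) + (inner ℂ u f + inner ℂ vp (Complex.I • wp)) := rfl
  have q5 : ‖g + Complex.I • e‖ ^ 2 = 2 * ‖ep‖ ^ 2 := by
    rw [k6, norm_smul, mul_pow, Complex.norm_real, Real.norm_eq_abs, sq_abs,
      Real.sq_sqrt zero_le_two]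
  have q6 : ‖g - Complex.I • e‖ ^ 2 = 2 * ‖em‖ ^ 2 := by
    rw [k7, norm_smul, mul_pow, Complex.norm_real, Real.norm_eq_abs, sq_abs,
      Real.sq_sqrt zero_le_two]
  have q7 := norm_add_sq (𝕜 := ℂ) g (Complex.I • e)
  have q8 := norm_sub_sq (𝕜 := ℂ) g (Complex.I • e)
  have q9 : RCLike.re (inner ℂ g (Complex.I • e)) = (inner ℂ e g).im := by
    rw [inner_smul_right, ← inner_conj_symm]
    change (Complex.I * conj (inner ℂ e g)).re = _
    rw [Complex.I_mul_re, Complex.conj_im, neg_neg]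
  rw [q9] at q7 q8
  rw [q4, inner_smul_right, inner_smul_right, Complex.add_im, Complex.add_im, Complex.I_mul_im,
    Complex.I_mul_im, q3]
  linarith

theorem dilation_sub_apply {z : ℂ} {vm hm : L2 E (Iio 0)} {u h : H} {vp hp : L2 E (Ioi 0)}
    {e g em ep : E} (h1 : IsWeakDeriv vm (-Complex.I • (hm + z • vm)))
    (h2 : T.BoundaryData u (h + z • u) e g) (h3 : IsWeakDeriv vp (-Complex.I • (hp + z • vp)))
    (h4 : HasBoundaryValue vm em) (h5 : HasBoundaryValue vp ep)
    (h6 : g + Complex.I • e = ((√2 : ℝ) : ℂ) • ep)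
    (h7 : g - Complex.I • e = ((√2 : ℝ) : ℂ) • em) :
    ∃ hx : triple vm u vp ∈ T.dilation.domain,
      T.dilation ⟨_, hx⟩ - z • triple vm u vp = triple hm h hp := by
  obtain ⟨hx, hD⟩ := dilation_iff.2 ⟨h1, h3, e, g, em, ep, h2, h4, h5, h6, h7⟩
  refine ⟨hx, ?_⟩
  rw [hD]
  have e1 := (neg_I_smul_eq_iff z vm _ hm).2 rfl
  have e2 : h + z • u - z • u = h := add_sub_cancel_right _ _
  have e3 := (neg_I_smul_eq_iff z vp _ hp).2 rfl
  exact WithLp.ofLp_injective 2 (Prod.ext e1 (WithLp.ofLp_injective 2 (Prod.ext e2 e3)))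

omit [CompleteSpace E] in
-- For `e = t + K (√2 a)` and `g = c e + √2 a`, one combination of `g` and `c e` returns the
-- prescribed value `a`, while the other produces the opposite boundary value. With `c = ±i` the
-- operator `I + 2 c K` in it is the scattering factor.
theorem boundary_condition {c : ℂ} (K : E →L[ℂ] E) (t a : E) :
    c • (t + K (((√2 : ℝ) : ℂ) • a)) + ((√2 : ℝ) : ℂ) • a - c • (t + K (((√2 : ℝ) : ℂ) • a)) =
      ((√2 : ℝ) : ℂ) • a ∧
    c • (t + K (((√2 : ℝ) : ℂ) • a)) + ((√2 : ℝ) : ℂ) • a + c • (t + K (((√2 : ℝ) : ℂ) • a)) =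
      ((√2 : ℝ) : ℂ) • ((c * ((√2 : ℝ) : ℂ)) • t + (a + (2 * c) • K a)) := by
  have h2 : ((√2 : ℝ) : ℂ) * ((√2 : ℝ) : ℂ) = 2 := by
    rw [← Complex.ofReal_mul, Real.mul_self_sqrt zero_le_two]
    norm_num
  refine ⟨add_sub_cancel_left _ _, ?_⟩
  rw [map_smul]
  match_scalars
  · linear_combination -c * h2
  · ring
  · ring

theorem adjoint_S_apply {z : ℂ} (hz : z.im < 0) (e : E) : (T.S (conj z)).adjoint e =
    e + (2 * Complex.I) • boundedInverse (subScalar (T.M z) Complex.I) e := by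
  have h := T.adjoint_boundedInverse_M_sub (z := z) (w := Complex.I) (by simpa using hz)
  rw [Complex.conj_I] at h
  have hid : (ContinuousLinearMap.id ℂ E).adjoint = ContinuousLinearMap.id ℂ E :=
    ContinuousLinearMap.adjoint_id
  rw [S, map_sub, LinearIsometryEquiv.map_smulₛₗ, h, hid, map_mul, Complex.conj_I, mul_neg,
    neg_smul, sub_neg_eq_add, map_ofNat]
  rfl

/-- Brings `S(z)` to the shape `I + 2 c K` with `c = -i`, matching `boundary_condition`. -/
theorem S_apply_eq (z : ℂ) (e : E) : T.S z e =
    e + (2 * -Complex.I) • boundedInverse (subScalar (T.M z) (-Complex.I)) e := by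
  rw [mul_neg, neg_smul, ← sub_eq_add_neg]
  rfl

theorem exists_dilation_solution_of_im_neg {z : ℂ} (hz : z.im < 0) (hm : L2 E (Iio 0)) (h : H)
    (hp : L2 E (Ioi 0)) :
    ∃ (f : H) (fp : L2 E (Ioi 0)),
      f = T.kreinResolvent z Complex.I h + ((√2 : ℝ) : ℂ) •
        T.γ z (boundedInverse (subScalar (T.M z) Complex.I)
          (boundaryValue (resolventOp (momentum E (Iio 0)) z hm))) ∧
      (∀ᵐ x ∂volume.restrict (Ioi (0 : ℝ)),
        fp x = resolventOp (momentumZero E (Ioi 0)) z hp x + Complex.exp (-Complex.I * z * x) •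
          ((Complex.I * ((√2 : ℝ) : ℂ)) • T.kreinTrace z Complex.I h +
            (T.S (conj z)).adjoint
              (boundaryValue (resolventOp (momentum E (Iio 0)) z hm)))) ∧
      ∃ hx : triple (resolventOp (momentum E (Iio 0)) z hm) f fp ∈ T.dilation.domain,
        T.dilation ⟨_, hx⟩ - z • triple (resolventOp (momentum E (Iio 0)) z hm) f fp =
          triple hm h hp := by
  have hw := isHalfLine_Iio.isWeakDeriv_resolvent_momentum (z := z) (by linarith) hm
  have hb := isHalfLine_Iio.hasBoundaryValue hw
  set a := boundaryValue (resolventOp (momentum E (Iio 0)) z hm)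
  set K := boundedInverse (subScalar (T.M z) Complex.I) with hK
  obtain ⟨fp, k1, k2, k3⟩ := isHalfLine_Ioi.exists_solution (z := z) (by linarith) hp
    ((Complex.I * ((√2 : ℝ) : ℂ)) • T.kreinTrace z Complex.I h + (T.S (conj z)).adjoint a)
  refine ⟨_, fp, rfl, k1, ?_⟩
  -- The condition at `0` on the negative half-line prescribes `Γ₁ f - i Γ₀ f = √2 f₋(0)`, whence
  -- the inhomogeneity `√2 a`.
  have hd := boundaryData_krein (T.mem_resolventSetOp_A₀ hz.ne)
    (hasBoundedInverse_M_sub (w := Complex.I) (by simpa using hz)) h (((√2 : ℝ) : ℂ) • a)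
  obtain ⟨c1, c2⟩ := boundary_condition (c := Complex.I) K (T.kreinTrace z Complex.I h) a
  rw [adjoint_S_apply hz] at k3
  rw [← hK] at hd
  rw [← (T.γ z).map_smul, ← K.map_smul]
  exact dilation_sub_apply hw hd k2 hb k3 c2 c1

theorem exists_dilation_solution_of_im_pos {z : ℂ} (hz : 0 < z.im) (hm : L2 E (Iio 0)) (h : H)
    (hp : L2 E (Ioi 0)) :
    ∃ (fm : L2 E (Iio 0)) (f : H),
      f = T.kreinResolvent z (-Complex.I) h + ((√2 : ℝ) : ℂ) •
        T.γ z (boundedInverse (subScalar (T.M z) (-Complex.I))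
          (boundaryValue (resolventOp (momentum E (Ioi 0)) z hp))) ∧
      (∀ᵐ x ∂volume.restrict (Iio (0 : ℝ)),
        fm x = resolventOp (momentumZero E (Iio 0)) z hm x + Complex.exp (-Complex.I * z * x) •
          (-(Complex.I * ((√2 : ℝ) : ℂ)) • T.kreinTrace z (-Complex.I) h +
            T.S z (boundaryValue (resolventOp (momentum E (Ioi 0)) z hp)))) ∧
      ∃ hx : triple fm f (resolventOp (momentum E (Ioi 0)) z hp) ∈ T.dilation.domain,
        T.dilation ⟨_, hx⟩ - z • triple fm f (resolventOp (momentum E (Ioi 0)) z hp) =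
          triple hm h hp := by
  have hw := isHalfLine_Ioi.isWeakDeriv_resolvent_momentum (z := z) (by linarith) hp
  have hb := isHalfLine_Ioi.hasBoundaryValue hw
  set a := boundaryValue (resolventOp (momentum E (Ioi 0)) z hp)
  set K := boundedInverse (subScalar (T.M z) (-Complex.I)) with hK
  obtain ⟨fm, k1, k2, k3⟩ := isHalfLine_Iio.exists_solution (z := z) (by linarith) hm
    (-(Complex.I * ((√2 : ℝ) : ℂ)) • T.kreinTrace z (-Complex.I) h + T.S z a)
  refine ⟨fm, _, rfl, k1, ?_⟩
  -- Now the positive half-line prescribes the data, through `Γ₁ f + i Γ₀ f = √2 f₊(0)`; hence `w =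
  -- -i`.
  have hd := boundaryData_krein (T.mem_resolventSetOp_A₀ hz.ne')
    (hasBoundedInverse_M_sub (w := -Complex.I) (by simpa using hz)) h (((√2 : ℝ) : ℂ) • a)
  obtain ⟨c1, c2⟩ := boundary_condition (c := -Complex.I) K (T.kreinTrace z (-Complex.I) h) a
  rw [S_apply_eq, ← neg_mul] at k3
  rw [← hK] at hd
  rw [← (T.γ z).map_smul, ← K.map_smul]
  refine dilation_sub_apply k2 hd hw k3 hb ?_ ?_
  · simpa only [neg_smul, sub_neg_eq_add] using c1
  · simpa only [neg_smul, sub_eq_add_neg] using c2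

theorem dilation_sub_surjective {z : ℂ} (hz : z.im ≠ 0) (y : DilationSpace H E) :
    ∃ x, subScalar T.dilation z x = y := by
  rcases lt_or_gt_of_ne hz with h | h
  · obtain ⟨_, _, -, -, hx, h'⟩ :=
      exists_dilation_solution_of_im_neg (T := T) h y.fst y.snd.fst y.snd.snd
    exact ⟨⟨_, hx⟩, h'⟩
  · obtain ⟨_, _, -, -, hx, h'⟩ :=
      exists_dilation_solution_of_im_pos (T := T) h y.fst y.snd.fst y.snd.snd
    exact ⟨⟨_, hx⟩, h'⟩

theorem isSelfAdjoint_dilation : IsSelfAdjoint T.dilation :=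
  isSelfAdjoint_of_surjective dilation_inner_im fun _ hz => T.dilation_sub_surjective hz

theorem mem_resolventSetOp_dilation {z : ℂ} (hz : z.im ≠ 0) : z ∈ resolventSetOp T.dilation :=
  HasBoundedInverse.of_symmetric (D := T.dilation) dilation_inner_im hz
    (T.dilation_sub_surjective hz)

theorem resolventOp_L {z : ℂ} (hz : z.im < 0) :
    resolventOp T.L z = T.kreinResolvent z Complex.I :=
  boundedInverse_eq (isBoundedInverse_L_sub_of_im_neg hz)

theorem resolventOp_adjoint_L {z : ℂ} (hz : 0 < z.im) :
    resolventOp T.L.adjoint z = T.kreinResolvent z (-Complex.I) :=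
  boundedInverse_eq (isBoundedInverse_adjoint_L_sub hz)

end RyzhovTriple

/-! ### Extension of `L`, compression and the resolvent formulas -/

namespace RyzhovTriple

open HalfLine

variable {H E : Type*} [NormedAddCommGroup H] [InnerProductSpace ℂ H] [CompleteSpace H]
  [NormedAddCommGroup E] [InnerProductSpace ℂ E] [CompleteSpace E] {T : RyzhovTriple H E}

theorem mem_L_domain_iff_triple_mem {u : H} :
    u ∈ T.L.domain ↔ ∃ vp, triple 0 u vp ∈ T.dilation.domain := by
  constructor
  · intro hu
    obtain ⟨e, he⟩ := L_iff.1 ⟨hu, rfl⟩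
    -- On `dom L` one has `Γ₁ u + i Γ₀ u = 2 i e`, so `v₊(0)` must be `2 i e / √2`; the parameter
    -- `-i` gives the decaying function `e^{-x}` with this value at `0`.
    obtain ⟨vp, -, h2, h3⟩ := isHalfLine_Ioi.exists_exp (E := E) (z := -Complex.I) (by simp)
      ((((√2 : ℝ) : ℂ)⁻¹) • ((2 * Complex.I) • e))
    have h0 : IsWeakDeriv (0 : L2 E (Iio 0)) 0 := (weakDerivGraph (Iio 0)).zero_mem
    have h4 : ((√2 : ℝ) : ℂ) ≠ 0 := by simp
    obtain ⟨hx, -⟩ := (dilation_iff (T := T)).2 ⟨h0, h2, _, _, _, _, he, HasBoundaryValue.zero,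
      h3, by rw [smul_inv_smul₀ h4, mul_smul, two_smul], by rw [sub_self, smul_zero]⟩
    exact ⟨vp, hx⟩
  · rintro ⟨vp, -, -, hu, em, ep, h1, -, -, h2⟩
    obtain rfl := h1.unique isOpen_Iio (by simp) HasBoundaryValue.zero
    rw [smul_zero, sub_eq_zero] at h2
    exact (L_iff.2 ⟨_, boundaryData_iff.2 ⟨hu, rfl, rfl, h2⟩⟩).1

theorem dilation_triple_zero (u : T.L.domain) (vp : L2 E (Ioi 0))
    (h : triple 0 (u : H) vp ∈ T.dilation.domain) :
    (T.dilation ⟨_, h⟩).fst = 0 ∧ (T.dilation ⟨_, h⟩).snd.fst = T.L u := by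
  obtain ⟨e, he⟩ := L_iff.1 ⟨u.2, rfl⟩
  obtain ⟨_, h2, -⟩ := boundaryData_iff.1 he
  refine ⟨?_, h2⟩
  have h3 : (T.dilation ⟨_, h⟩).fst = Complex.I • sobolevDeriv E (Iio 0) 0 := rfl
  rw [h3, LinearPMap.map_zero, smul_zero]

theorem resolventOp_dilation_triple_zero {z : ℂ} (hz : z.im < 0) (h : H) :
    (resolventOp T.dilation z (triple 0 h 0)).snd.fst = resolventOp T.L z h := by
  obtain ⟨f, fp, hf, -, hx, h'⟩ := exists_dilation_solution_of_im_neg (T := T) hz 0 h 0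
  rw [resolventOp_apply_eq (mem_resolventSetOp_dilation hz.ne) hx h', resolventOp_L hz]
  -- With `h₋ = 0` the component on `ℝ₋` vanishes, and with it the correction through `γ(z)`.
  rw [map_zero, isHalfLine_Iio.boundaryValue_eq HasBoundaryValue.zero, map_zero, map_zero,
    smul_zero, add_zero] at hf
  exact hf

/-- The constructed solution is the resolvent by uniqueness. What remains is to recognise
`kreinTrace` as `Γ₀ (L - z)⁻¹ h`, which is read off from the boundary data of `kreinResolvent`. -/
theorem resolventOp_dilation_of_im_neg {z : ℂ} (hz : z.im < 0) (hm : L2 E (Iio 0)) (h : H)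
    (hp : L2 E (Ioi 0)) :
    ∃ (fm : L2 E (Iio 0)) (f : H) (fp : L2 E (Ioi 0))
      (hd : resolventOp T.L z h ∈ T.Γ₀.domain),
      resolventOp T.dilation z (triple hm h hp) = triple fm f fp ∧
      fm = resolventOp (momentum E (Iio 0)) z hm ∧
      f = resolventOp T.L z h + ((√2 : ℝ) : ℂ) •
        T.γ z (boundedInverse (subScalar (T.M z) Complex.I) (boundaryValue fm)) ∧
      ∀ᵐ x ∂volume.restrict (Ioi (0 : ℝ)),
        fp x = resolventOp (momentumZero E (Ioi 0)) z hp x + Complex.exp (-Complex.I * z * x) •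
          ((Complex.I * ((√2 : ℝ) : ℂ)) • T.Γ₀ ⟨resolventOp T.L z h, hd⟩ +
            (T.S (star z)).adjoint (boundaryValue fm)) := by
  obtain ⟨f, fp, hf, hfp, hx, h'⟩ := exists_dilation_solution_of_im_neg (T := T) hz hm h hp
  obtain ⟨hu, -, h1, -⟩ := boundaryData_iff.1 (boundaryData_kreinResolvent
    (T.mem_resolventSetOp_A₀ hz.ne) (hasBoundedInverse_M_sub (w := Complex.I) (by simpa using hz)) h)
  simp only [resolventOp_L hz]
  refine ⟨_, f, fp, T.Γ₁_domain_le_Γ₀ hu,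
    resolventOp_apply_eq (mem_resolventSetOp_dilation hz.ne) hx h', rfl, hf, ?_⟩
  rw [h1]
  exact hfp

theorem resolventOp_dilation_of_im_pos {z : ℂ} (hz : 0 < z.im) (hm : L2 E (Iio 0)) (h : H)
    (hp : L2 E (Ioi 0)) :
    ∃ (fm : L2 E (Iio 0)) (f : H) (fp : L2 E (Ioi 0))
      (hd : resolventOp T.L.adjoint z h ∈ T.Γ₀.domain),
      resolventOp T.dilation z (triple hm h hp) = triple fm f fp ∧
      fp = resolventOp (momentum E (Ioi 0)) z hp ∧
      f = resolventOp T.L.adjoint z h + ((√2 : ℝ) : ℂ) •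
        T.γ z (boundedInverse (subScalar (T.M z) (-Complex.I)) (boundaryValue fp)) ∧
      ∀ᵐ x ∂volume.restrict (Iio (0 : ℝ)),
        fm x = resolventOp (momentumZero E (Iio 0)) z hm x + Complex.exp (-Complex.I * z * x) •
          (-(Complex.I * ((√2 : ℝ) : ℂ)) • T.Γ₀ ⟨resolventOp T.L.adjoint z h, hd⟩ +
            T.S z (boundaryValue fp)) := by
  obtain ⟨fm, f, hf, hfm, hx, h'⟩ := exists_dilation_solution_of_im_pos (T := T) hz hm h hp
  obtain ⟨hu, -, h1, -⟩ := boundaryData_iff.1 (boundaryData_kreinResolvent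
    (T.mem_resolventSetOp_A₀ hz.ne')
    (hasBoundedInverse_M_sub (w := -Complex.I) (by simpa using hz)) h)
  simp only [resolventOp_adjoint_L hz]
  refine ⟨fm, f, _, T.Γ₁_domain_le_Γ₀ hu,
    resolventOp_apply_eq (mem_resolventSetOp_dilation hz.ne') hx h', rfl, hf, ?_⟩
  rw [h1]
  exact hfm

end RyzhovTriple

theorem mainTheorem3 {H E : Type*}
    [NormedAddCommGroup H] [InnerProductSpace ℂ H] [CompleteSpace H]
    [TopologicalSpace.SeparableSpace H]
    [NormedAddCommGroup E] [InnerProductSpace ℂ E] [CompleteSpace E]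
    (T : RyzhovTriple H E) :
    -- `L = A_{-iI, I}` is a maximal dissipative operator, with the resolvent that defines it
    IsMaximalDissipative T.L ∧
    (∀ z ∈ resolventSetOp T.A₀, HasBoundedInverse (subScalar (T.M z) Complex.I) →
      z ∈ resolventSetOp T.L ∧
      resolventOp T.L z = resolventOp T.A₀ z -
        T.γ z ∘L boundedInverse (subScalar (T.M z) Complex.I) ∘L T.Pi.adjoint ∘L
          (ContinuousLinearMap.id ℂ H + z • resolventOp T.A₀ z)) ∧
    -- the operator `𝒜` is self-adjoint
    IsSelfAdjoint T.dilation ∧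
    -- it extends `L`: the domain of `L` consists of the middle components of the elements
    -- `(0, u, vp)` of `dom 𝒜`, and on them the middle component of `𝒜` is `L`
    (∀ u : H, u ∈ T.L.domain ↔ ∃ vp, RyzhovTriple.triple 0 u vp ∈ T.dilation.domain) ∧
    (∀ (u : T.L.domain) (vp : HalfLine.L2 E (Set.Ioi 0))
      (h : RyzhovTriple.triple 0 (u : H) vp ∈ T.dilation.domain),
      (T.dilation ⟨_, h⟩).fst = 0 ∧ (T.dilation ⟨_, h⟩).snd.fst = T.L u) ∧
    -- and `𝒜` dilates `L`
    (∀ z : ℂ, z.im < 0 → ∀ h : H,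
      (resolventOp T.dilation z (RyzhovTriple.triple 0 h 0)).snd.fst = resolventOp T.L z h) ∧
    -- the resolvent of `𝒜` in the lower half-plane
    (∀ z : ℂ, z.im < 0 →
      z ∈ resolventSetOp T.A₀ ∧ z ∈ resolventSetOp T.L ∧
      HasBoundedInverse (subScalar (T.M z) Complex.I) ∧
      HasBoundedInverse (subScalar (T.M (star z)) (-Complex.I)) ∧
      z ∈ resolventSetOp (HalfLine.momentum E (Set.Iio 0)) ∧
      z ∈ resolventSetOp (HalfLine.momentumZero E (Set.Ioi 0)) ∧
      z ∈ resolventSetOp T.dilation ∧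
      ∀ (hm : HalfLine.L2 E (Set.Iio 0)) (h : H) (hp : HalfLine.L2 E (Set.Ioi 0)),
        ∃ (fm : HalfLine.L2 E (Set.Iio 0)) (f : H) (fp : HalfLine.L2 E (Set.Ioi 0))
          (hd : resolventOp T.L z h ∈ T.Γ₀.domain),
          resolventOp T.dilation z (RyzhovTriple.triple hm h hp) =
            RyzhovTriple.triple fm f fp ∧
          fm = resolventOp (HalfLine.momentum E (Set.Iio 0)) z hm ∧
          f = resolventOp T.L z h + ((√2 : ℝ) : ℂ) •
            T.γ z (boundedInverse (subScalar (T.M z) Complex.I) (HalfLine.boundaryValue fm)) ∧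
          ∀ᵐ x ∂(MeasureTheory.volume.restrict (Set.Ioi (0 : ℝ))),
            fp x = resolventOp (HalfLine.momentumZero E (Set.Ioi 0)) z hp x +
              Complex.exp (-Complex.I * z * x) •
                ((Complex.I * ((√2 : ℝ) : ℂ)) • T.Γ₀ ⟨resolventOp T.L z h, hd⟩ +
                  (T.S (star z)).adjoint (HalfLine.boundaryValue fm))) ∧
    -- the resolvent of `𝒜` in the upper half-plane
    (∀ z : ℂ, 0 < z.im →
      z ∈ resolventSetOp T.A₀ ∧ z ∈ resolventSetOp T.L.adjoint ∧
      HasBoundedInverse (subScalar (T.M z) (-Complex.I)) ∧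
      z ∈ resolventSetOp (HalfLine.momentum E (Set.Ioi 0)) ∧
      z ∈ resolventSetOp (HalfLine.momentumZero E (Set.Iio 0)) ∧
      z ∈ resolventSetOp T.dilation ∧
      ∀ (hm : HalfLine.L2 E (Set.Iio 0)) (h : H) (hp : HalfLine.L2 E (Set.Ioi 0)),
        ∃ (fm : HalfLine.L2 E (Set.Iio 0)) (f : H) (fp : HalfLine.L2 E (Set.Ioi 0))
          (hd : resolventOp T.L.adjoint z h ∈ T.Γ₀.domain),
          resolventOp T.dilation z (RyzhovTriple.triple hm h hp) =
            RyzhovTriple.triple fm f fp ∧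
          fp = resolventOp (HalfLine.momentum E (Set.Ioi 0)) z hp ∧
          f = resolventOp T.L.adjoint z h + ((√2 : ℝ) : ℂ) •
            T.γ z (boundedInverse (subScalar (T.M z) (-Complex.I))
              (HalfLine.boundaryValue fp)) ∧
          ∀ᵐ x ∂(MeasureTheory.volume.restrict (Set.Iio (0 : ℝ))),
            fm x = resolventOp (HalfLine.momentumZero E (Set.Iio 0)) z hm x +
              Complex.exp (-Complex.I * z * x) •
                (-(Complex.I * ((√2 : ℝ) : ℂ)) • T.Γ₀ ⟨resolventOp T.L.adjoint z h, hd⟩ +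
                  T.S z (HalfLine.boundaryValue fp))) := by
  refine ⟨RyzhovTriple.isMaximalDissipative_L, fun z hz hM => ?_,
    RyzhovTriple.isSelfAdjoint_dilation, fun u => RyzhovTriple.mem_L_domain_iff_triple_mem,
    RyzhovTriple.dilation_triple_zero,
    fun z hz h => RyzhovTriple.resolventOp_dilation_triple_zero hz h,
    fun z hz => ⟨T.mem_resolventSetOp_A₀ hz.ne, ⟨_, T.isBoundedInverse_L_sub_of_im_neg hz⟩,
      T.hasBoundedInverse_M_sub (by simpa using hz),
      T.hasBoundedInverse_M_sub (by simpa using hz),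
      HalfLine.isHalfLine_Iio.mem_resolventSetOp_momentum (by linarith),
      HalfLine.isHalfLine_Ioi.mem_resolventSetOp_momentumZero (by linarith),
      RyzhovTriple.mem_resolventSetOp_dilation hz.ne,
      RyzhovTriple.resolventOp_dilation_of_im_neg hz⟩,
    fun z hz => ⟨T.mem_resolventSetOp_A₀ hz.ne', ⟨_, T.isBoundedInverse_adjoint_L_sub hz⟩,
      T.hasBoundedInverse_M_sub (by simpa using hz),
      HalfLine.isHalfLine_Ioi.mem_resolventSetOp_momentum (by linarith),
      HalfLine.isHalfLine_Iio.mem_resolventSetOp_momentumZero (by linarith),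
      RyzhovTriple.mem_resolventSetOp_dilation hz.ne',
      RyzhovTriple.resolventOp_dilation_of_im_pos hz⟩⟩
  exact ⟨⟨_, T.isBoundedInverse_L_sub hz hM⟩, boundedInverse_eq (T.isBoundedInverse_L_sub hz hM)⟩
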